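/- Let $n$ items be placed at independent, uniformly distributed points $U_1,\dots,U_n$ of a circle of length $1$ (identified with $[0,1)$), and let a picker start at the point $0$ and move along the circle at unit speed. Let $T_n$ be the minimal travel time needed to collect all items, i.e. the minimum, over all orders $\sigma$ of the items, of $d(0,U_{\sigma(1)})+\sum_{i=2}^{n} d(U_{\sigma(i-1)},U_{\sigma(i)})$, where $d$ is the length of a shortest arc. Let $X_1,X_2,\dots,X'_1,X'_2,\dots$ be independent exponential random variables with mean $1$. Then the series $\sum_{j\ge1}(2^j-1)^{-1}X_j$ and $\sum_{j\ge1}(2^j-1)^{-1}X'_j$ converge almost surely, and, as $n\to\infty$, $$(n+1)(1-T_n)\ \xrightarrow{d}\ \max\Big\{\sum_{j=1}^{\infty}\frac{1}{2^j-1}X_j,\ \sum_{j=1}^{\infty}\frac{1}{2^j-1}X'_j\Big\}.$$ The limiting distribution is given, for every $t\ge 0$, by $$\lim_{n\to\infty}\mathbb P\Big(T_n>1-\frac{t}{n+1}\Big)=\mathbb P\Big(\max\Big\{\sum_{j=1}^{\infty}\frac{X_j}{2^j-1},\ \sum_{j=1}^{\infty}\frac{X'_j}{2^j-1}\Big\}\le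 t\Big)=[P(t)]^2,$$ where $$P(t)=1-\sum_{j=1}^{\infty}(-1)^{j-1}2^j\exp\{-(2^j-1)t\}\prod_{l=1}^{j}\frac{1}{2^l-1},\qquad t\ge0,$$ the series being absolutely convergent. -/

import Mathlib

open MeasureTheory ProbabilityTheory Filter Topology

noncomputable section

/-- Travel time (at unit speed) of a picker who starts at the point `0` of the circle of length `1`
and collects the items at positions `u` in the order `u (σ 0), u (σ 1), …`, always moving along a
shortest arc; `dist` on `UnitAddCircle` is the length of a shortest arc. -/
def travelTime {n : ℕ} (u : Fin n → UnitAddCircle) (σ : Equiv.Perm (Fin n)) : ℝ :=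
  let site : Fin (n + 1) → UnitAddCircle := Fin.cons 0 (u ∘ σ)
  ∑ i : Fin n, dist (site i.castSucc) (site i.succ)

/-- The minimal travel time needed to collect all items, over all picking orders. -/
def minTravelTime {n : ℕ} (u : Fin n → UnitAddCircle) : ℝ :=
  ⨅ σ : Equiv.Perm (Fin n), travelTime u σ

/-- The summand with index `j + 1` of `J = ∑_{j ≥ 1} x_j / (2 ^ j - 1)`, where `x j` stands for
`x_{j+1}`. -/
def jTerm (x : ℕ → ℝ) (j : ℕ) : ℝ := x j / (2 ^ (j + 1) - 1)

/-- The summand with index `j + 1` of the series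
`∑_{j ≥ 1} (-1)^(j-1) 2^j exp(-(2^j - 1) t) ∏_{l=1}^j 1 / (2^l - 1)`. -/
def pTerm (t : ℝ) (j : ℕ) : ℝ :=
  (-1) ^ j * 2 ^ (j + 1) * Real.exp (-(2 ^ (j + 1) - 1) * t) *
    ∏ l ∈ Finset.Icc 1 (j + 1), (1 / ((2 : ℝ) ^ l - 1))

/-- `P(t)`, for `t ≥ 0` (the series diverges for `t < 0`). -/
def limitP (t : ℝ) : ℝ := 1 - ∑' j : ℕ, pTerm t j

end

/-! ### The minimal travel time in terms of the gaps between sorted positions -/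

/-! Sort the sites as `0 = v 0 ≤ v 1 ≤ … ≤ v (n + 1) = 1`. A route lifted to the line either has
range at least `1` or leaves out some gap from `v k` to `v (k + 1)`; in the latter case it runs
twice over one of the two arcs joining that gap to the start. Hence `1 - T` is the maximum over the
gaps of the gap length minus the shorter of these arcs (`lt_minTravelTime_iff`).

Since `T` is symmetric in the sites, uniform points may be replaced by normalized partial sums of `n
+ 1` standard exponentials (`lintegral_pi_uniform_eq_lintegral_pi_exp`). Reading the left half of
the spacings from one i.i.d. sequence and the right half, backwards, from another puts all `n` on
one probability space. By the law of large numbers the total of the spacings is asymptotic to `n +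
1`, and gaps far from `0` are useless because the arc to be run twice is too long. So the scaled
saving converges almost surely to `max M M'`, where `M = sup_k (Y_k - (Y_0 + ⋯ + Y_{k-1}))` and `M'`
is its copy for the other sequence (`tendsto_scaledSaving`).

`M` and `∑ Y_j / (2 ^ j - 1)` are different variables with the same law. Truncated at `m` terms,
both have distribution function `finiteP m` on `[0, ∞)`. For the supremum this follows by
conditioning on the first exponential, for the sum by conditioning on the last; the two recursions
have the same solution (`integral_exp_mul_finiteP`, `integral_exp_mul_finiteP_sub`). Dominated
convergence as `m → ∞` gives `limitP`, and independence of the two sequences gives its square. -/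

lemma minTravelTime_comp_perm {n : ℕ} (u : Fin n → UnitAddCircle) (τ : Equiv.Perm (Fin n)) :
    minTravelTime (u ∘ τ) = minTravelTime u :=
  (Equiv.mulLeft τ).iInf_congr fun _ => rfl

lemma travelTime_neg {n : ℕ} (u : Fin n → UnitAddCircle) (σ : Equiv.Perm (Fin n)) :
    travelTime (fun i => -u i) σ = travelTime u σ := by
  have h : ∀ i : Fin (n + 1),
      (Fin.cons 0 ((fun i => -u i) ∘ σ) : Fin (n + 1) → UnitAddCircle) i
        = -(Fin.cons 0 (u ∘ σ) : Fin (n + 1) → UnitAddCircle) i := by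
    intro i
    refine Fin.cases ?_ (fun j => ?_) i <;> simp
  simp only [travelTime, h, dist_neg_neg]

lemma minTravelTime_neg {n : ℕ} (u : Fin n → UnitAddCircle) :
    minTravelTime (fun i => -u i) = minTravelTime u := by
  simp only [minTravelTime, travelTime_neg]

lemma minTravelTime_le_travelTime {n : ℕ} (u : Fin n → UnitAddCircle) (σ : Equiv.Perm (Fin n)) :
    minTravelTime u ≤ travelTime u σ :=
  ciInf_le (Set.finite_range _).bddBelow σ

lemma exists_travelTime_eq_minTravelTime {n : ℕ} (u : Fin n → UnitAddCircle) :
    ∃ σ, travelTime u σ = minTravelTime u :=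
  exists_eq_ciInf_of_finite

/-- A route that follows the lift `y` of the visited sites takes at most the variation of `y`. -/
lemma travelTime_le_sum_abs {n : ℕ} (u : Fin n → UnitAddCircle) (σ : Equiv.Perm (Fin n))
    (y : ℕ → ℝ) (h0 : y 0 = 0) (hy : ∀ i : Fin n, ((y (i + 1) : ℝ) : UnitAddCircle) = u (σ i)) :
    travelTime u σ ≤ ∑ i ∈ Finset.range n, |y (i + 1) - y i| := by
  have hs : ∀ i : Fin (n + 1),
      (Fin.cons 0 (u ∘ σ) : Fin (n + 1) → UnitAddCircle) i = ((y i : ℝ) : UnitAddCircle) := by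
    intro i
    refine Fin.cases ?_ (fun j => ?_) i
    · simp [h0]
    · simp [hy j]
  rw [← Fin.sum_univ_eq_sum_range (fun i => |y (i + 1) - y i|)]
  refine Finset.sum_le_sum fun i _ => ?_
  rw [hs, hs, dist_comm, dist_eq_norm, ← AddCircle.coe_sub]
  simpa using QuotientAddGroup.norm_mk_le_norm (S := AddSubgroup.zmultiples (1 : ℝ))
    (m := y (i + 1) - y i)

lemma exists_lift_dist_eq (x : ℝ) (q : UnitAddCircle) :
    ∃ y : ℝ, (y : UnitAddCircle) = q ∧ |y - x| = dist (x : UnitAddCircle) q := by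
  obtain ⟨z, rfl⟩ := QuotientAddGroup.mk_surjective q
  refine ⟨z - round (z - x), ?_, ?_⟩
  · have : ((round (z - x) : ℝ) : UnitAddCircle) = 0 := by
      have := AddCircle.coe_eq_zero_iff (1 : ℝ) (x := (round (z - x) : ℝ))
      rw [this]
      exact ⟨round (z - x), by simp⟩
    rw [AddCircle.coe_sub, this, sub_zero]
  · rw [dist_comm, dist_eq_norm]
    have : ((z : UnitAddCircle) - (x : UnitAddCircle)) = ((z - x : ℝ) : UnitAddCircle) := rfl
    erw [this]
    rw [UnitAddCircle.norm_eq]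
    congr 1; ring

/-- Each site is lifted to a representative nearest to the previous lifted point, so that a route on
the circle becomes a path on the line with the same step lengths. -/
lemma exists_lift_path (s : ℕ → UnitAddCircle) (h0 : s 0 = 0) :
    ∃ y : ℕ → ℝ, y 0 = 0 ∧ ∀ i, ((y i : ℝ) : UnitAddCircle) = s i ∧
      |y (i + 1) - y i| = dist (s i) (s (i + 1)) := by
  choose f hf hd using exists_lift_dist_eq
  obtain ⟨y, hy0, hys⟩ : ∃ y : ℕ → ℝ, y 0 = 0 ∧ ∀ i, y (i + 1) = f (y i) (s (i + 1)) :=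
    ⟨fun n => Nat.rec 0 (fun i x => f x (s (i + 1))) n, rfl, fun _ => rfl⟩
  have hy : ∀ i : ℕ, ((y i : ℝ) : UnitAddCircle) = s i := by
    intro i
    cases i with
    | zero => simp [hy0, h0]
    | succ i => rw [hys, hf]
  refine ⟨y, hy0, fun i => ⟨hy i, ?_⟩⟩
  rw [← hy i, hys, hd]

lemma exists_lift_travelTime_eq {n : ℕ} (u : Fin n → UnitAddCircle) (σ : Equiv.Perm (Fin n)) :
    ∃ y : ℕ → ℝ, y 0 = 0 ∧ (∀ i : Fin n, ((y (i + 1) : ℝ) : UnitAddCircle) = u (σ i)) ∧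
      travelTime u σ = ∑ i ∈ Finset.range n, |y (i + 1) - y i| := by
  let site : Fin (n + 1) → UnitAddCircle := Fin.cons 0 (u ∘ σ)
  let s : ℕ → UnitAddCircle := fun i => if h : i < n + 1 then site ⟨i, h⟩ else 0
  obtain ⟨y, hy0, hy⟩ := exists_lift_path s (by simp [s, site])
  refine ⟨y, hy0, fun i => ?_, ?_⟩
  · rw [(hy _).1]
    have : s (i + 1) = site i.succ := by simp [s, Fin.succ]
    rw [this]
    simp [site]
  · rw [← Fin.sum_univ_eq_sum_range (fun i => |y (i + 1) - y i|)]
    refine Finset.sum_congr rfl fun i _ => ?_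
    rw [(hy _).2]
    have h1 : s i = site i.castSucc := by
      simp only [s]; rw [dif_pos (by omega)]; rfl
    have h2 : s (i + 1) = site i.succ := by simp [s, Fin.succ]
    rw [h1, h2]

lemma abs_sub_le_sum_abs (y : ℕ → ℝ) {p q : ℕ} (hpq : p ≤ q) :
    |y q - y p| ≤ ∑ i ∈ Finset.Ico p q, |y (i + 1) - y i| := by
  rw [← Finset.sum_Ico_sub _ hpq]
  exact Finset.abs_sum_le_sum_abs _ _

/-- A path on the line from `0` that visits `y p` and `y q` runs twice over one of the legs. -/
lemma le_sum_abs_of_visits (y : ℕ → ℝ) (h0 : y 0 = 0) {n p q : ℕ} (hp : p ≤ n) (hq : q ≤ n) :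
    y p - y q + min (y p) (-y q) ≤ ∑ i ∈ Finset.range n, |y (i + 1) - y i| := by
  have key : ∀ a b, a ≤ b → b ≤ n →
      |y a| + |y b - y a| ≤ ∑ i ∈ Finset.range n, |y (i + 1) - y i| := by
    intro a b hab hb
    have h1 := abs_sub_le_sum_abs y (Nat.zero_le a)
    have h2 := abs_sub_le_sum_abs y hab
    rw [h0, sub_zero] at h1
    have h3 := Finset.sum_Ico_consecutive (fun i => |y (i + 1) - y i|) (Nat.zero_le a) hab
    have h4 : ∑ i ∈ Finset.Ico 0 b, |y (i + 1) - y i|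
        ≤ ∑ i ∈ Finset.range n, |y (i + 1) - y i| := by
      rw [Finset.range_eq_Ico]
      exact Finset.sum_le_sum_of_subset_of_nonneg (Finset.Ico_subset_Ico le_rfl hb)
        fun _ _ _ => abs_nonneg _
    linarith
  rcases le_total p q with h | h
  · have := key p q h hq
    have h1 := le_abs_self (y p)
    have h2 := neg_abs_le (y q - y p)
    have h3 := min_le_left (y p) (-y q)
    linarith
  · have := key q p h hp
    have h1 := neg_abs_le (y q)
    have h2 := le_abs_self (y p - y q)
    have h3 := min_le_right (y p) (-y q)
    linarith

/-- The route that collects the items before the `k`-th gap in increasing order, and then the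
others in decreasing order. -/
lemma minTravelTime_le_of_gap {n : ℕ} (v : ℕ → ℝ) (hv : Monotone v) (h0 : v 0 = 0)
    (h1 : v (n + 1) = 1) {k : ℕ} (hk : k ≤ n) :
    minTravelTime (fun i : Fin n => ((v (i + 1) : ℝ) : UnitAddCircle))
      ≤ 2 * v k + 1 - v (k + 1) := by
  -- Fixes the indices below `k` and reverses the block from `k` to `n - 1`.
  let f : Fin n → Fin n := fun i => if h : i.1 < k then i else ⟨n - 1 + k - i, by omega⟩
  have hf : Function.Involutive f := by
    intro i
    simp only [f]
    by_cases h : i.1 < k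
    · simp [h]
    · have := i.2
      rw [dif_neg h, dif_neg]
      · ext; simp; omega
      · simp; omega
  let σ : Equiv.Perm (Fin n) := hf.toPerm f
  -- After `v k` the path turns back through `0` and continues on the negative side, where the site
  -- `v j` has the lift `v j - 1`.
  let y : ℕ → ℝ := fun i => if i ≤ k then v i else v (n + 1 + k - i) - 1
  have hy0 : y 0 = 0 := by simp [y, h0]
  have hy : ∀ i : Fin n,
      ((y (i + 1) : ℝ) : UnitAddCircle) = ((v (σ i + 1) : ℝ) : UnitAddCircle) := by
    intro i
    have hi := i.2
    by_cases h : i.1 < k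
    · have : σ i = i := by simp [σ, f, h]
      rw [this]
      simp only [y]
      rw [if_pos (by omega)]
    · have : ((σ i : Fin n) : ℕ) = n - 1 + k - i := by simp [σ, f, h]
      rw [this]
      simp only [y]
      rw [if_neg (by omega), AddCircle.coe_sub, show n + 1 + k - (i.1 + 1) = n - 1 + k - i + 1 by omega]
      have h1 : ((1 : ℝ) : UnitAddCircle) = 0 := AddCircle.coe_period 1
      rw [h1, sub_zero]
  refine (minTravelTime_le_travelTime _ σ).trans ((travelTime_le_sum_abs _ σ y hy0 hy).trans ?_)
  have hA : ∀ m ≤ k, ∑ i ∈ Finset.range m, |y (i + 1) - y i| = v m := by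
    intro m hm
    induction m with
    | zero => simp [h0]
    | succ m ih =>
      rw [Finset.sum_range_succ, ih (by omega)]
      simp only [y]
      rw [if_pos hm, if_pos (by omega), abs_of_nonneg (sub_nonneg.2 (hv (by omega)))]
      ring
  -- Only an inequality: at `m = 0` the path has not turned back, and the bound already allows for
  -- the return to `0`.
  have hB : ∀ m, k + m ≤ n → ∑ i ∈ Finset.range (k + m), |y (i + 1) - y i|
      ≤ 2 * v k + 1 - v (n + 1 - m) := by
    intro m hm
    have hvk : 0 ≤ v k := h0 ▸ hv (Nat.zero_le k)
    induction m with
    | zero =>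
      rw [add_zero, hA k le_rfl, Nat.sub_zero, h1]
      linarith
    | succ m ih =>
      rw [← add_assoc, Finset.sum_range_succ]
      have := ih (by omega)
      rcases Nat.eq_zero_or_pos m with rfl | hm0
      · simp only [y, add_zero, hA k le_rfl]
        rw [if_neg (by omega), if_pos le_rfl, show n + 1 + k - (k + 1) = n by omega]
        have hvn : v n ≤ 1 := h1 ▸ hv (by omega)
        rw [abs_of_nonpos (by linarith)]
        simp
        linarith
      · have e : |y (k + m + 1) - y (k + m)| = v (n + 1 - m) - v (n + 1 - (m + 1)) := by
          simp only [y]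
          rw [if_neg (by omega), if_neg (by omega),
            show n + 1 + k - (k + m + 1) = n + 1 - (m + 1) by omega,
            show n + 1 + k - (k + m) = n + 1 - m by omega]
          have := hv (show n + 1 - (m + 1) ≤ n + 1 - m by omega)
          rw [abs_of_nonpos (by linarith)]
          ring
        rw [e]
        linarith
  have := hB (n - k) (by omega)
  rwa [show k + (n - k) = n by omega, show n + 1 - (n - k) = k + 1 by omega] at this

/-- The reflection `x ↦ 1 - x` preserves travel times and exchanges gap `k` with gap `n - k`. -/
lemma minTravelTime_le_of_gap_reverse {n : ℕ} (v : ℕ → ℝ) (hv : Monotone v) (h0 : v 0 = 0)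
    (h1 : v (n + 1) = 1) {k : ℕ} (hk : k ≤ n) :
    minTravelTime (fun i : Fin n => ((v (i + 1) : ℝ) : UnitAddCircle))
      ≤ 2 * (1 - v (k + 1)) + v k := by
  have h := minTravelTime_le_of_gap (n := n) (fun i => 1 - v (n + 1 - i))
    (fun a b hab => sub_le_sub_left (hv (by omega)) 1) (by simp [h1]) (by simp [h0])
    (k := n - k) (by omega)
  simp only [show n + 1 - (n - k) = k + 1 by omega, show n + 1 - (n - k + 1) = k by omega] at h
  have e : (fun i : Fin n => ((1 - v (n + 1 - (i.1 + 1)) : ℝ) : UnitAddCircle))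
      = (fun i => -(fun i : Fin n => ((v (i + 1) : ℝ) : UnitAddCircle)) i) ∘ Fin.revPerm := by
    funext i
    have h1 : ((1 : ℝ) : UnitAddCircle) = 0 := AddCircle.coe_period 1
    have hi := i.2
    simp only [Function.comp, Fin.revPerm_apply, Fin.val_rev, AddCircle.coe_sub, h1, zero_sub]
    congr 3; omega
  rw [e, minTravelTime_comp_perm, minTravelTime_neg] at h
  linarith

/-- Every route leaves out a gap, and runs twice over one of the two arcs between it and `0`. -/
lemma exists_gap_le_travelTime {n : ℕ} (v : ℕ → ℝ) (hv : Monotone v) (h0 : v 0 = 0)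
    (h1 : v (n + 1) = 1) (σ : Equiv.Perm (Fin n)) :
    ∃ k ≤ n, 1 - v (k + 1) + v k + min (v k) (1 - v (k + 1))
      ≤ travelTime (fun i : Fin n => ((v (i + 1) : ℝ) : UnitAddCircle)) σ := by
  obtain ⟨y, hy0, hy, hT⟩ :=
    exists_lift_travelTime_eq (fun i : Fin n => ((v (i + 1) : ℝ) : UnitAddCircle)) σ
  rw [hT]
  obtain ⟨p, hp, hpmax⟩ := Finset.exists_max_image (Finset.range (n + 1)) y ⟨0, by simp⟩
  obtain ⟨q, hq, hqmin⟩ := Finset.exists_min_image (Finset.range (n + 1)) y ⟨0, by simp⟩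
  have hL := le_sum_abs_of_visits y hy0 (n := n) (p := p) (q := q)
    (by simpa [Nat.lt_succ_iff] using hp) (by simpa [Nat.lt_succ_iff] using hq)
  have hb : 0 ≤ y p := hy0 ▸ hpmax 0 (by simp)
  have ha : y q ≤ 0 := hy0 ▸ hqmin 0 (by simp)
  have hv1 : ∀ j ≤ n + 1, v j ≤ 1 := fun j hj => h1 ▸ hv hj
  have hv0 : ∀ j, 0 ≤ v j := fun j => h0 ▸ hv (Nat.zero_le j)
  -- A lifted path whose range has length at least `1` is no shorter than one full turn, and gap `0`
  -- then serves.
  by_cases hlen : 1 ≤ y p - y q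
  · refine ⟨0, Nat.zero_le n, ?_⟩
    have hm : 0 ≤ min (y p) (-y q) := le_min hb (by linarith)
    have := hv0 (0 + 1)
    have h3 : min (v 0) (1 - v (0 + 1)) ≤ v 0 := min_le_left _ _
    rw [h0] at h3 ⊢
    linarith
  push Not at hlen
  -- The lifts lie in `(-1, 1)` and `v j` in `[0, 1]`, so they differ by the integer `0` or `1`:
  -- each site is reached from the left or from the right.
  have hcov : ∀ j ≤ n + 1, v j ≤ y p ∨ y q + 1 ≤ v j := by
    intro j hj
    rcases Nat.eq_zero_or_pos j with rfl | hj0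
    · left; rw [h0]; exact hb
    rcases hj.eq_or_lt with rfl | hjn
    · right; rw [h1]; linarith
    have hi : j - 1 < n := by omega
    let i : Fin n := σ.symm ⟨j - 1, hi⟩
    have hyi := hy i
    have hσ : ((σ i : Fin n) : ℕ) + 1 = j := by simp [i]; omega
    simp only [hσ] at hyi
    have hmem : (i : ℕ) + 1 ∈ Finset.range (n + 1) := by simp
    have hle := hpmax _ hmem
    have hge := hqmin _ hmem
    obtain ⟨z, hz⟩ : ∃ z : ℤ, v j - y (i + 1) = z := by
      rw [eq_comm, ← sub_eq_zero, ← AddCircle.coe_sub, AddCircle.coe_eq_zero_iff] at hyi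
      obtain ⟨z, hz⟩ := hyi
      exact ⟨z, by rw [← hz]; simp⟩
    have hz1 : z = 0 ∨ z = 1 := by
      have a1 : (z : ℝ) < 2 := by have := hv1 j hj; linarith
      have a2 : (-1 : ℝ) < z := by have := hv0 j; linarith
      have b1 : z < 2 := by exact_mod_cast a1
      have b2 : -1 < z := by exact_mod_cast a2
      omega
    rcases hz1 with rfl | rfl
    · left; push_cast at hz; linarith
    · right; push_cast at hz; linarith
  -- The omitted gap ends at the first site of the second kind.
  have hex : ∃ j, j ≤ n + 1 ∧ y q + 1 ≤ v j := ⟨n + 1, le_rfl, by rw [h1]; linarith⟩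
  classical
  have hf := Nat.find_spec hex
  have hf0 : Nat.find hex ≠ 0 := by
    intro h
    rw [h, h0] at hf
    have := hf.2
    linarith
  obtain ⟨k, hk⟩ := Nat.exists_eq_succ_of_ne_zero hf0
  have hnot := Nat.find_min hex (m := k) (by omega)
  rw [hk] at hf
  have hkn : k ≤ n := by have := hf.1; omega
  have hvk : v k ≤ y p := by
    rcases hcov k (by omega) with h | h
    · exact h
    · exact absurd ⟨by omega, h⟩ hnot
  have hvk1 : y q + 1 ≤ v (k + 1) := hf.2
  refine ⟨k, hkn, le_trans ?_ hL⟩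
  have := min_le_min hvk (show 1 - v (k + 1) ≤ -y q by linarith)
  linarith

/-- The two inequalities for each gap correspond to running twice over the left or the right arc.
Strictness survives because an optimal order exists. -/
lemma lt_minTravelTime_iff {n : ℕ} (v : ℕ → ℝ) (hv : Monotone v) (h0 : v 0 = 0)
    (h1 : v (n + 1) = 1) (s : ℝ) :
    1 - s < minTravelTime (fun i : Fin n => ((v (i + 1) : ℝ) : UnitAddCircle)) ↔
      ∀ k ≤ n, v (k + 1) - 2 * v k < s ∧ 2 * v (k + 1) - v k - 1 < s := by
  constructor
  · intro h k hk
    have a := minTravelTime_le_of_gap v hv h0 h1 hk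
    have b := minTravelTime_le_of_gap_reverse v hv h0 h1 hk
    constructor <;> linarith
  · intro h
    obtain ⟨σ, hσ⟩ :=
      exists_travelTime_eq_minTravelTime (fun i : Fin n => ((v (i + 1) : ℝ) : UnitAddCircle))
    obtain ⟨k, hk, hle⟩ := exists_gap_le_travelTime v hv h0 h1 σ
    rw [← hσ]
    refine lt_of_lt_of_le ?_ hle
    obtain ⟨a, b⟩ := h k hk
    rcases min_choice (v k) (1 - v (k + 1)) with e | e <;> rw [e] <;> linarith

/-! ### The finite and infinite exponential sums -/

/-- The coefficient of `exp (-(2 ^ j - 1) t)` in `limitP t`. -/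
noncomputable def limitCoeff (j : ℕ) : ℝ :=
  (-2) ^ j * ∏ l ∈ Finset.Icc 1 j, (1 / ((2 : ℝ) ^ l - 1))

/-- The correction to `limitCoeff j` caused by truncation at `m` terms. It vanishes for `j > m` and
tends to `1` as `m → ∞`. -/
noncomputable def qProd (m j : ℕ) : ℝ := ∏ i ∈ Finset.range j, (1 - (2 : ℝ) ^ i / 2 ^ m)

/-- The distribution function on `[0, ∞)` of `∑_{j = 1}^m X_j / (2 ^ j - 1)`, for independent
standard exponential variables `X_j`. -/
noncomputable def finiteP (m : ℕ) (t : ℝ) : ℝ :=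
  ∑ j ∈ Finset.range (m + 1), limitCoeff j * qProd m j * Real.exp (-(2 ^ j - 1) * t)

lemma two_pow_succ_sub_one_pos (j : ℕ) : (0 : ℝ) < 2 ^ (j + 1) - 1 :=
  sub_pos.2 (one_lt_pow₀ one_lt_two (Nat.succ_ne_zero j))

lemma limitCoeff_zero : limitCoeff 0 = 1 := by simp [limitCoeff]

lemma limitCoeff_succ (j : ℕ) : limitCoeff (j + 1) = -2 * limitCoeff j / (2 ^ (j + 1) - 1) := by
  rw [limitCoeff, limitCoeff, Finset.prod_Icc_succ_top (by omega)]
  ring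

lemma limitCoeff_ne_zero (j : ℕ) : limitCoeff j ≠ 0 := by
  refine mul_ne_zero (pow_ne_zero _ (by norm_num)) (Finset.prod_ne_zero_iff.2 fun l hl => ?_)
  obtain ⟨k, rfl⟩ := Nat.exists_eq_succ_of_ne_zero
    (Nat.one_le_iff_ne_zero.1 (Finset.mem_Icc.1 hl).1)
  exact one_div_ne_zero (two_pow_succ_sub_one_pos k).ne'

lemma qProd_zero (m : ℕ) : qProd m 0 = 1 := by simp [qProd]

lemma qProd_succ (m j : ℕ) : qProd m (j + 1) = qProd m j * (1 - 2 ^ j / 2 ^ m) := by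
  simp [qProd, Finset.prod_range_succ]

lemma qProd_succ_succ (m j : ℕ) :
    qProd (m + 1) (j + 1) = qProd m j * (1 - 1 / 2 ^ (m + 1)) := by
  rw [qProd, qProd, Finset.prod_range_succ', pow_zero]
  congr 1
  refine Finset.prod_congr rfl fun i _ => ?_
  rw [pow_succ, pow_succ, mul_div_mul_right _ _ two_ne_zero]

lemma qProd_eq_zero {m j : ℕ} (h : m < j) : qProd m j = 0 :=
  Finset.prod_eq_zero (Finset.mem_range.2 h) (by simp)

lemma qProd_nonneg (m j : ℕ) : 0 ≤ qProd m j := by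
  rcases lt_or_ge m j with h | h
  · rw [qProd_eq_zero h]
  · refine Finset.prod_nonneg fun i hi => sub_nonneg.2 ?_
    rw [div_le_one (by positivity)]
    exact pow_le_pow_right₀ one_le_two (by have := Finset.mem_range.1 hi; omega)

lemma qProd_le_one (m j : ℕ) : qProd m j ≤ 1 := by
  rcases lt_or_ge m j with h | h
  · rw [qProd_eq_zero h]; exact zero_le_one
  · refine Finset.prod_le_one (fun i hi => sub_nonneg.2 ?_) fun i hi => ?_
    · rw [div_le_one (by positivity)]
      exact pow_le_pow_right₀ one_le_two (by have := Finset.mem_range.1 hi; omega)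
    · have : (0 : ℝ) ≤ 2 ^ i / 2 ^ m := by positivity
      linarith

lemma tendsto_qProd (j : ℕ) : Tendsto (fun m => qProd m j) atTop (𝓝 1) := by
  have h : Tendsto (fun m : ℕ => qProd m j) atTop (𝓝 (∏ i ∈ Finset.range j, (1 - 0))) := by
    refine tendsto_finsetProd _ fun i _ => tendsto_const_nhds.sub ?_
    have := (tendsto_pow_atTop_nhds_zero_of_lt_one (r := (1 / 2 : ℝ)) (by norm_num)
      (by norm_num)).const_mul ((2 : ℝ) ^ i)
    rw [mul_zero] at this
    refine this.congr fun m => ?_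
    rw [one_div, inv_pow, div_eq_mul_inv]
  simpa using h

lemma finiteP_zero (t : ℝ) : finiteP 0 t = 1 := by
  simp [finiteP, limitCoeff_zero, qProd_zero]

lemma coeff_succ_left (m j : ℕ) (hj : j ≤ m) :
    limitCoeff j * qProd (m + 1) j
      = limitCoeff j * qProd m j * ((2 ^ (m + 1) - 1) / (2 ^ (m + 1) - 2 ^ j)) := by
  have h1 : (2 : ℝ) ^ j < 2 ^ (m + 1) := pow_lt_pow_right₀ one_lt_two (by omega)
  have h2 := qProd_succ (m + 1) j
  rw [qProd_succ_succ] at h2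
  have h3 : (2 : ℝ) ^ (m + 1) - 2 ^ j ≠ 0 := (sub_pos.2 h1).ne'
  have h4 : (2 : ℝ) ^ (m + 1) ≠ 0 := by positivity
  rw [mul_assoc, eq_comm]
  congr 1
  field_simp at h2 ⊢
  linarith

/-- A Pascal-type rule: the two parts are what the terms `j + 1` and `j` contribute to the same
exponential in `integral_exp_mul_finiteP`. -/
lemma coeff_succ_succ (m j : ℕ) :
    limitCoeff (j + 1) * qProd (m + 1) (j + 1)
      = limitCoeff (j + 1) * qProd m (j + 1) / 2 ^ (j + 1)
        - limitCoeff j * qProd m j / 2 ^ j := by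
  have h1 := (two_pow_succ_sub_one_pos j).ne'
  rw [limitCoeff_succ, qProd_succ_succ, qProd_succ]
  have h2 : (2 : ℝ) ^ j ≠ 0 := by positivity
  have h3 : (2 : ℝ) ^ m ≠ 0 := by positivity
  rw [pow_succ] at h1
  rw [pow_succ, pow_succ]
  generalize (2 : ℝ) ^ j = a at *
  generalize (2 : ℝ) ^ m = b at *
  rw [mul_comm a 2] at h1 ⊢
  field_simp
  ring

/-! ### Two integral recursions for `finiteP` -/

lemma integral_exp_neg_mul {a : ℝ} (ha : a ≠ 0) (t : ℝ) :
    ∫ y in (0 : ℝ)..t, Real.exp (-a * y) = (1 - Real.exp (-a * t)) / a := by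
  rw [intervalIntegral.integral_comp_mul_left (fun x => Real.exp x) (neg_ne_zero.2 ha),
    integral_exp, mul_zero, Real.exp_zero, smul_eq_mul]
  field_simp
  ring

/-- The recursion for the supremum, with `y` the first exponential. The density turns the rate `2 ^
j - 1` into `2 ^ j` in `y`, and the upper limit `t` adds this to the rate in `t`, which gives `2 ^
(j + 1) - 1`: this is where powers of two enter. -/
lemma integral_exp_mul_finiteP (m : ℕ) (t : ℝ) :
    ∫ y in (0 : ℝ)..t, Real.exp (-y) * finiteP m (t + y) = finiteP (m + 1) t := by
  have h1 : ∀ y, Real.exp (-y) * finiteP m (t + y)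
      = ∑ j ∈ Finset.range (m + 1), limitCoeff j * qProd m j * Real.exp (-(2 ^ j - 1) * t)
        * Real.exp (-2 ^ j * y) := by
    intro y
    rw [finiteP, Finset.mul_sum]
    refine Finset.sum_congr rfl fun j _ => ?_
    rw [mul_left_comm, mul_assoc _ (Real.exp _), ← Real.exp_add, ← Real.exp_add]
    congr 2; ring
  simp_rw [h1]
  rw [intervalIntegral.integral_finsetSum
    (fun j _ => Continuous.intervalIntegrable (by fun_prop) _ _)]
  simp_rw [intervalIntegral.integral_const_mul, integral_exp_neg_mul (a := 2 ^ _) (by positivity)]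
  have h2 : ∀ j, limitCoeff j * qProd m j * Real.exp (-(2 ^ j - 1) * t)
        * ((1 - Real.exp (-2 ^ j * t)) / 2 ^ j)
      = limitCoeff j * qProd m j / 2 ^ j * Real.exp (-(2 ^ j - 1) * t)
        - limitCoeff j * qProd m j / 2 ^ j * Real.exp (-(2 ^ (j + 1) - 1) * t) := by
    intro j
    rw [show -((2 : ℝ) ^ (j + 1) - 1) * t = -(2 ^ j - 1) * t + -2 ^ j * t by ring, Real.exp_add]
    ring
  simp_rw [h2]
  have hlast : limitCoeff (m + 1) * qProd m (m + 1) = 0 := by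
    rw [qProd_eq_zero (Nat.lt_succ_self m), mul_zero]
  rw [Finset.sum_sub_distrib, finiteP, Finset.sum_range_succ' _ (m + 1)]
  simp_rw [coeff_succ_succ, sub_mul]
  rw [Finset.sum_sub_distrib, Finset.sum_range_succ' _ m]
  rw [Finset.sum_range_succ (fun j => limitCoeff (j + 1) * qProd m (j + 1) / 2 ^ (j + 1)
    * Real.exp (-(2 ^ (j + 1) - 1) * t)), hlast]
  simp only [qProd_zero, pow_zero]
  ring

/-- Says that the coefficients of `finiteP (m + 1)` sum to zero; the other recursion needs exactly
this identity. -/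
lemma finiteP_succ_at_zero (m : ℕ) : finiteP (m + 1) 0 = 0 := by
  rw [← integral_exp_mul_finiteP, intervalIntegral.integral_same]

/-- The recursion for the sum, with `y` the last exponential. Every term yields its own exponential
and a multiple of the new one, whose total coefficient is fixed by the vanishing at `t = 0`. -/
lemma integral_exp_mul_finiteP_sub (m : ℕ) (t : ℝ) :
    ∫ y in (0 : ℝ)..((2 ^ (m + 1) - 1) * t),
      Real.exp (-y) * finiteP m (t - y / (2 ^ (m + 1) - 1)) = finiteP (m + 1) t := by
  have hL := two_pow_succ_sub_one_pos m
  set L : ℝ := 2 ^ (m + 1) - 1 with hLdef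
  have hpos : ∀ j ∈ Finset.range (m + 1), (0 : ℝ) < 2 ^ (m + 1) - 2 ^ j := fun j hj =>
    sub_pos.2 (pow_lt_pow_right₀ one_lt_two (Finset.mem_range.1 hj))
  have h1 : ∀ y, Real.exp (-y) * finiteP m (t - y / L)
      = ∑ j ∈ Finset.range (m + 1), limitCoeff j * qProd m j * Real.exp (-(2 ^ j - 1) * t)
        * Real.exp (-((2 ^ (m + 1) - 2 ^ j) / L) * y) := by
    intro y
    rw [finiteP, Finset.mul_sum]
    refine Finset.sum_congr rfl fun j _ => ?_
    rw [mul_left_comm, mul_assoc _ (Real.exp _), ← Real.exp_add, ← Real.exp_add]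
    congr 2
    have : (2 : ℝ) ^ (m + 1) = L + 1 := by rw [hLdef]; ring
    rw [this]
    field_simp
    ring
  simp_rw [h1]
  rw [intervalIntegral.integral_finsetSum
    (fun j _ => Continuous.intervalIntegrable (by fun_prop) _ _)]
  have h2 : ∀ j ∈ Finset.range (m + 1),
      ∫ y in (0 : ℝ)..(L * t), limitCoeff j * qProd m j * Real.exp (-(2 ^ j - 1) * t)
        * Real.exp (-((2 ^ (m + 1) - 2 ^ j) / L) * y)
      = limitCoeff j * qProd (m + 1) j * Real.exp (-(2 ^ j - 1) * t)
        - limitCoeff j * qProd (m + 1) j * Real.exp (-L * t) := by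
    intro j hj
    have hj' := hpos j hj
    rw [intervalIntegral.integral_const_mul, integral_exp_neg_mul (div_pos hj' hL).ne',
      coeff_succ_left m j (by have := Finset.mem_range.1 hj; omega), ← hLdef,
      show -L * t = -(2 ^ j - 1) * t + -((2 ^ (m + 1) - 2 ^ j) / L) * (L * t) by
        field_simp; rw [hLdef]; ring, Real.exp_add]
    field_simp
  rw [Finset.sum_congr rfl h2, Finset.sum_sub_distrib, ← Finset.sum_mul]
  have h0 := finiteP_succ_at_zero m
  simp only [finiteP, mul_zero, Real.exp_zero, mul_one] at h0
  rw [Finset.sum_range_succ] at h0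
  rw [finiteP, Finset.sum_range_succ _ (m + 1), ← hLdef]
  linear_combination (-Real.exp (-L * t)) * h0

lemma continuous_finiteP (m : ℕ) : Continuous (finiteP m) := by
  unfold finiteP
  fun_prop

/-! ### The limit of many terms -/

lemma summable_abs_limitCoeff : Summable fun j => |limitCoeff j| := by
  refine summable_of_ratio_test_tendsto_lt_one (l := 0) one_pos
    (Eventually.of_forall fun j => abs_ne_zero.2 (limitCoeff_ne_zero j)) ?_
  have h : Tendsto (fun j : ℕ => 2 / ((2 : ℝ) ^ (j + 1) - 1)) atTop (𝓝 0) := by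
    refine Tendsto.const_div_atTop ?_ _
    exact tendsto_atTop_add_const_right _ _
      ((tendsto_pow_atTop_atTop_of_one_lt one_lt_two).comp (tendsto_add_atTop_nat 1))
  refine h.congr fun j => ?_
  have hj := two_pow_succ_sub_one_pos j
  have := abs_pos.2 (limitCoeff_ne_zero j)
  rw [limitCoeff_succ, norm_abs_eq_norm, norm_abs_eq_norm, Real.norm_eq_abs, Real.norm_eq_abs,
    abs_div, abs_mul, abs_of_pos hj]
  norm_num
  field_simp

lemma abs_limitCoeff_mul_exp_le (j : ℕ) {t : ℝ} (ht : 0 ≤ t) :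
    |limitCoeff j * Real.exp (-(2 ^ j - 1) * t)| ≤ |limitCoeff j| := by
  rw [abs_mul, Real.abs_exp]
  refine mul_le_of_le_one_right (abs_nonneg _) (Real.exp_le_one_iff.2 ?_)
  have : (1 : ℝ) ≤ 2 ^ j := one_le_pow₀ one_le_two
  nlinarith

lemma pTerm_eq (t : ℝ) (j : ℕ) :
    pTerm t j = -(limitCoeff (j + 1) * Real.exp (-(2 ^ (j + 1) - 1) * t)) := by
  rw [pTerm, limitCoeff, show ((-2 : ℝ)) ^ (j + 1) = -((-1) ^ j * 2 ^ (j + 1)) by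
    rw [neg_pow, pow_succ (-1 : ℝ)]; ring]
  ring

lemma summable_limitCoeff_mul_exp {t : ℝ} (ht : 0 ≤ t) :
    Summable fun j => limitCoeff j * Real.exp (-(2 ^ j - 1) * t) :=
  Summable.of_norm_bounded summable_abs_limitCoeff fun j => abs_limitCoeff_mul_exp_le j ht

lemma summable_pTerm {t : ℝ} (ht : 0 ≤ t) : Summable (pTerm t) := by
  simp_rw [funext (pTerm_eq t)]
  exact ((summable_nat_add_iff 1).2 (summable_limitCoeff_mul_exp ht)).neg

lemma limitP_eq_tsum {t : ℝ} (ht : 0 ≤ t) :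
    limitP t = ∑' j, limitCoeff j * Real.exp (-(2 ^ j - 1) * t) := by
  rw [(summable_limitCoeff_mul_exp ht).tsum_eq_zero_add, limitP, limitCoeff_zero]
  simp_rw [pTerm_eq]
  rw [tsum_neg]
  simp

lemma tendsto_finiteP {t : ℝ} (ht : 0 ≤ t) :
    Tendsto (fun m => finiteP m t) atTop (𝓝 (limitP t)) := by
  have h : ∀ m, finiteP m t
      = ∑' j, limitCoeff j * qProd m j * Real.exp (-(2 ^ j - 1) * t) := by
    intro m
    rw [finiteP, eq_comm]
    refine tsum_eq_sum fun j hj => ?_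
    rw [qProd_eq_zero (by simpa using hj)]
    simp
  simp_rw [h]
  rw [limitP_eq_tsum ht]
  refine tendsto_tsum_of_dominated_convergence summable_abs_limitCoeff (fun j => ?_)
    (Eventually.of_forall fun m j => ?_)
  · have := ((tendsto_qProd j).const_mul (limitCoeff j)).mul_const
      (Real.exp (-(2 ^ j - 1) * t))
    rwa [mul_one] at this
  · rw [mul_right_comm, norm_mul, Real.norm_eq_abs, Real.norm_eq_abs, abs_of_nonneg (qProd_nonneg m j)]
    exact (mul_le_of_le_one_right (abs_nonneg _) (qProd_le_one m j)).trans
      (abs_limitCoeff_mul_exp_le j ht)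

lemma limitP_at_zero : limitP 0 = 0 := by
  refine tendsto_nhds_unique (tendsto_finiteP le_rfl) ?_
  rw [← tendsto_add_atTop_iff_nat 1]
  simp_rw [finiteP_succ_at_zero]
  exact tendsto_const_nhds

/-- With `max t 0` the function extends to the whole line as the constant `limitP 0 = 0` on the
left; its square will be the limiting distribution function, which therefore has no atoms. -/
lemma continuous_limitP_max : Continuous fun t : ℝ => limitP (max t 0) := by
  simp_rw [fun t : ℝ => limitP_eq_tsum (le_max_right t 0)]
  exact continuous_tsum (fun j => by fun_prop) summable_abs_limitCoeff
    fun j t => abs_limitCoeff_mul_exp_le j (le_max_right t 0)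

/-! ### Functionals of independent exponential variables -/

/-- A family of independent, everywhere positive, standard exponential random variables. -/
structure IsIIDExp {ι Ω : Type*} [MeasurableSpace Ω] (Y : ι → Ω → ℝ) (ν : Measure Ω) : Prop where
  measurable : ∀ i, Measurable (Y i)
  pos : ∀ i ω, 0 < Y i ω
  hasLaw : ∀ i, HasLaw (Y i) (expMeasure 1) ν
  indep : iIndepFun Y ν

instance isProbabilityMeasure_expMeasure_one : IsProbabilityMeasure (expMeasure 1) :=
  isProbabilityMeasure_expMeasure one_pos

lemma lintegral_expMeasure_one {f : ℝ → ENNReal} (hf : Measurable f) :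
    ∫⁻ y, f y ∂expMeasure 1 = ∫⁻ y in Set.Ioi 0, ENNReal.ofReal (Real.exp (-y)) * f y := by
  have h : expMeasure 1 = volume.withDensity (exponentialPDF 1) := rfl
  have hm : Measurable (exponentialPDF 1) := (measurable_exponentialPDFReal 1).ennreal_ofReal
  rw [h, lintegral_withDensity_eq_lintegral_mul _ hm hf, ← lintegral_indicator measurableSet_Ioi]
  refine lintegral_congr_ae ?_
  have h0 : ∀ᵐ y : ℝ, y ≠ 0 := by simp [ae_iff]
  filter_upwards [h0] with y hy
  rcases lt_or_gt_of_ne hy with hlt | hgt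
  · simp [exponentialPDF_of_neg hlt, not_lt.2 hlt.le]
  · simp [exponentialPDF_of_nonneg hgt.le, Set.indicator_of_mem (Set.mem_Ioi.2 hgt)]

/-- Brings a conditional probability that vanishes beyond `T` to the form of the two recursions for
`finiteP`. -/
lemma lintegral_expMeasure_one_eq_ofReal {φ : ℝ → ENNReal} (hφ : Measurable φ) {f : ℝ → ℝ}
    (hf : Continuous f) {T : ℝ} (hT : 0 ≤ T) (hf0 : ∀ y, 0 < y → y ≤ T → 0 ≤ f y)
    (h1 : ∀ y, 0 < y → y ≤ T → φ y = ENNReal.ofReal (f y)) (h2 : ∀ y, T < y → φ y = 0) :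
    ∫⁻ y, φ y ∂expMeasure 1 = ENNReal.ofReal (∫ y in (0 : ℝ)..T, Real.exp (-y) * f y) := by
  rw [lintegral_expMeasure_one hφ, intervalIntegral.integral_of_le hT,
    ofReal_integral_eq_lintegral_ofReal]
  · rw [← lintegral_indicator measurableSet_Ioi, ← lintegral_indicator measurableSet_Ioc]
    refine lintegral_congr fun y => ?_
    by_cases h : y ∈ Set.Ioc 0 T
    · rw [Set.indicator_of_mem h, Set.indicator_of_mem (Set.mem_Ioi.2 h.1), h1 y h.1 h.2,
        ENNReal.ofReal_mul (Real.exp_pos _).le]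
    · rw [Set.indicator_of_notMem h]
      by_cases hy : y ∈ Set.Ioi 0
      · rw [Set.indicator_of_mem hy, h2 y (not_le.1 fun hle => h ⟨hy, hle⟩), mul_zero]
      · rw [Set.indicator_of_notMem hy]
  · exact (Continuous.integrableOn_Icc (by fun_prop)).mono_set Set.Ioc_subset_Icc_self
  · refine (ae_restrict_iff' measurableSet_Ioc).2 (Eventually.of_forall fun y hy => ?_)
    exact mul_nonneg (Real.exp_pos _).le (hf0 y hy.1 hy.2)

lemma comap_pi_le_iSup_comap {ι κ Ω : Type*} (Y : ι → Ω → ℝ) (g : κ → ι) :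
    MeasurableSpace.comap (fun ω k => Y (g k) ω) MeasurableSpace.pi
      ≤ ⨆ i ∈ Set.range g, MeasurableSpace.comap (Y i) inferInstance := by
  rw [← measurable_iff_comap_le, @measurable_pi_iff]
  intro k
  rw [measurable_iff_comap_le]
  exact le_iSup₂_of_le (g k) ⟨k, rfl⟩ le_rfl

lemma indepFun_comp_of_disjoint_range {ι κ κ' Ω : Type*} [MeasurableSpace Ω] {ν : Measure Ω}
    {Y : ι → Ω → ℝ} (hY : ∀ i, Measurable (Y i)) (h : iIndepFun Y ν) (g : κ → ι) (g' : κ' → ι)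
    (hd : Disjoint (Set.range g) (Set.range g')) :
    IndepFun (fun ω k => Y (g k) ω) (fun ω k => Y (g' k) ω) ν :=
  indep_of_indep_of_le_left (indep_of_indep_of_le_right
    (indep_iSup_of_disjoint (fun i => (hY i).comap_le) h.iIndep hd)
    (comap_pi_le_iSup_comap Y g')) (comap_pi_le_iSup_comap Y g)

namespace IsIIDExp

variable {ι κ Ω : Type*} [MeasurableSpace Ω] {ν : Measure Ω} {Y : ι → Ω → ℝ}

lemma precomp (h : IsIIDExp Y ν) {g : κ → ι} (hg : Function.Injective g) :
    IsIIDExp (fun k => Y (g k)) ν where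
  measurable _ := h.measurable _
  pos _ := h.pos _
  hasLaw _ := h.hasLaw _
  indep := h.indep.precomp hg

/-- Conditioning on `Y i`: by independence of the block indexed by `g`, the joint law is a product
and Fubini applies. -/
lemma measure_eq_lintegral [IsProbabilityMeasure ν] (h : IsIIDExp Y ν) {i : ι} {g : κ → ι} (hi : ∀ k, g k ≠ i)
    {A : Set (ℝ × (κ → ℝ))} (hA : MeasurableSet A) :
    ν {ω | (Y i ω, fun k => Y (g k) ω) ∈ A}
      = ∫⁻ y, ν {ω | (y, fun k => Y (g k) ω) ∈ A} ∂expMeasure 1 := by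
  have hg : Measurable fun ω k => Y (g k) ω := measurable_pi_iff.2 fun k => h.measurable _
  have hd : Disjoint (Set.range fun _ : Unit => i) (Set.range g) := by
    rw [Set.disjoint_left]
    rintro _ ⟨_, rfl⟩ ⟨k, hk⟩
    exact hi k hk
  have h1 := (indepFun_comp_of_disjoint_range h.measurable h.indep _ g hd).comp
    (measurable_pi_apply ()) measurable_id
  have h2 : IndepFun (Y i) (fun ω k => Y (g k) ω) ν := h1
  rw [indepFun_iff_map_prod_eq_prod_map_map (h.measurable i).aemeasurable hg.aemeasurable,
    (h.hasLaw i).map_eq] at h2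
  have h3 : ν {ω | (Y i ω, fun k => Y (g k) ω) ∈ A}
      = ν.map (fun ω => (Y i ω, fun k => Y (g k) ω)) A := by
    rw [Measure.map_apply ((h.measurable i).prodMk hg) hA]; rfl
  have : IsProbabilityMeasure (ν.map fun ω k => Y (g k) ω) :=
    Measure.isProbabilityMeasure_map hg.aemeasurable
  rw [h3, h2, Measure.prod_apply hA]
  refine lintegral_congr fun y => ?_
  rw [Measure.map_apply hg (measurable_prodMk_left hA)]
  rfl

end IsIIDExp

section Laws

variable {Ω : Type*} [MeasurableSpace Ω] {ν : Measure Ω} [IsProbabilityMeasure ν]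

/-- The distribution function of `max_{k < m} (Y_k - (Y_0 + ⋯ + Y_{k-1}))`. -/
lemma measureReal_forall_le_sum (m : ℕ) {Y : ℕ → Ω → ℝ} (hY : IsIIDExp Y ν) {t : ℝ} (ht : 0 ≤ t) :
    ν.real {ω | ∀ k < m, Y k ω ≤ ∑ i ∈ Finset.range k, Y i ω + t} = finiteP m t := by
  -- Given `Y 0 = y ≤ t`, the other constraints are those of the shifted sequence at level `t + y`,
  -- so both sequence and level must vary.
  induction m generalizing Y t with
  | zero => simp [finiteP_zero]
  | succ m ih =>
    let A : Set (ℝ × (ℕ → ℝ)) :=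
      {p | p.1 ≤ t ∧ ∀ k < m, p.2 k ≤ ∑ i ∈ Finset.range k, p.2 i + (t + p.1)}
    have hA : MeasurableSet A := by
      have : A = {p | p.1 ≤ t} ∩
          ⋂ k ∈ Set.Iio m, {p | p.2 k ≤ ∑ i ∈ Finset.range k, p.2 i + (t + p.1)} := by
        ext p; simp [A]
      rw [this]
      exact (measurableSet_le (by fun_prop) (by fun_prop)).inter
        (MeasurableSet.biInter (Set.to_countable _) fun k _ =>
          measurableSet_le (by fun_prop) (by fun_prop))
    have e : {ω | ∀ k < m + 1, Y k ω ≤ ∑ i ∈ Finset.range k, Y i ω + t}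
        = {ω | (Y 0 ω, fun k => Y (k + 1) ω) ∈ A} := by
      ext ω
      simp only [Set.mem_ofPred_eq, A]
      constructor
      · intro h
        refine ⟨by simpa using h 0 (by omega), fun k hk => ?_⟩
        have := h (k + 1) (by omega)
        rw [Finset.sum_range_succ'] at this
        linarith
      · rintro ⟨h0, h⟩ k hk
        cases k with
        | zero => simpa using h0
        | succ k =>
          have := h k (by omega)
          rw [Finset.sum_range_succ']
          linarith
    have hY' : IsIIDExp (fun k => Y (k + 1)) ν := hY.precomp (add_left_injective 1)
    have ih' : ∀ y, 0 ≤ y →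
        ν {ω | ∀ k < m, Y (k + 1) ω ≤ ∑ i ∈ Finset.range k, Y (i + 1) ω + (t + y)}
          = ENNReal.ofReal (finiteP m (t + y)) := fun y hy => by
      rw [← ih hY' (add_nonneg ht hy), ofReal_measureReal]
    rw [measureReal_def, e, hY.measure_eq_lintegral (g := fun k => k + 1) (by simp) hA,
      lintegral_expMeasure_one_eq_ofReal (f := fun y => finiteP m (t + y)) (T := t) _ _ ht,
      integral_exp_mul_finiteP, ENNReal.toReal_ofReal]
    · rw [← integral_exp_mul_finiteP]
      refine intervalIntegral.integral_nonneg ht fun y hy => mul_nonneg (Real.exp_pos _).le ?_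
      rw [← ih hY' (add_nonneg ht hy.1)]
      exact measureReal_nonneg
    · intro y hy _
      rw [← ih hY' (add_nonneg ht hy.le)]
      exact measureReal_nonneg
    · intro y hy hyt
      rw [← ih' y hy.le]
      congr 1
      ext ω
      simp [A, hyt]
    · intro y hy
      simp [A, not_le.2 hy]
    · have hg : Measurable fun ω k => Y (k + 1) ω := measurable_pi_iff.2 fun k => hY.measurable _
      exact measurable_measure_prodMk_left (ν := ν)
        ((measurable_fst.prodMk (hg.comp measurable_snd)) hA)
    · exact (continuous_finiteP m).comp (by fun_prop)

/-- The distribution function of `∑_{j = 1}^m X_j / (2 ^ j - 1)`. -/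
lemma measureReal_sum_jTerm_le (m : ℕ) {Y : ℕ → Ω → ℝ} (hY : IsIIDExp Y ν) {t : ℝ} (ht : 0 ≤ t) :
    ν.real {ω | ∑ j ∈ Finset.range m, jTerm (fun j => Y j ω) j ≤ t} = finiteP m t := by
  induction m generalizing t with
  | zero => simp [finiteP_zero, ht]
  | succ m ih =>
    have hL := two_pow_succ_sub_one_pos m
    set L : ℝ := 2 ^ (m + 1) - 1 with hLdef
    let A : Set (ℝ × (Fin m → ℝ)) := {p | ∑ j : Fin m, p.2 j / (2 ^ (j.1 + 1) - 1) ≤ t - p.1 / L}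
    have hA : MeasurableSet A := measurableSet_le (by fun_prop) (by fun_prop)
    have e1 : ∀ ω, ∑ j ∈ Finset.range m, jTerm (fun j => Y j ω) j
        = ∑ j : Fin m, Y j ω / (2 ^ (j.1 + 1) - 1) := fun ω => by
      rw [← Fin.sum_univ_eq_sum_range]; rfl
    have e : {ω | ∑ j ∈ Finset.range (m + 1), jTerm (fun j => Y j ω) j ≤ t}
        = {ω | (Y m ω, fun k : Fin m => Y k ω) ∈ A} := by
      ext ω
      simp only [Set.mem_ofPred_eq, A, Finset.sum_range_succ, e1]
      rw [jTerm, le_sub_iff_add_le]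
    have hnn : ∀ ω, 0 ≤ ∑ j ∈ Finset.range m, jTerm (fun j => Y j ω) j := fun ω =>
      Finset.sum_nonneg fun j _ => div_nonneg (hY.pos j ω).le (two_pow_succ_sub_one_pos j).le
    have hsub : ∀ y, y ≤ L * t → 0 ≤ t - y / L := fun y hy => by
      rw [sub_nonneg, div_le_iff₀ hL, mul_comm]; exact hy
    rw [measureReal_def, e, hY.measure_eq_lintegral (g := fun k : Fin m => (k : ℕ))
        (fun k => k.2.ne) hA,
      lintegral_expMeasure_one_eq_ofReal (f := fun y => finiteP m (t - y / L)) (T := L * t) _ _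
        (by positivity),
      integral_exp_mul_finiteP_sub, ENNReal.toReal_ofReal]
    · rw [← integral_exp_mul_finiteP_sub]
      refine intervalIntegral.integral_nonneg (by positivity)
        fun y hy => mul_nonneg (Real.exp_pos _).le ?_
      rw [← ih (hsub y hy.2)]
      exact measureReal_nonneg
    · intro y _ hy
      rw [← ih (hsub y hy)]
      exact measureReal_nonneg
    · intro y _ hy
      rw [← ih (hsub y hy), ofReal_measureReal]
      simp only [e1]
      rfl
    · intro y hy
      have : {ω | (y, fun k : Fin m => Y k ω) ∈ A} = ∅ := by
        ext ω
        simp only [Set.mem_ofPred_eq, A, ← e1, Set.mem_empty_iff_false, iff_false, not_le]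
        refine lt_of_lt_of_le ?_ (hnn ω)
        rw [sub_neg, lt_div_iff₀ hL, mul_comm]
        exact hy
      rw [this, measure_empty]
    · have hg : Measurable fun ω (k : Fin m) => Y k ω :=
        measurable_pi_iff.2 fun k => hY.measurable _
      exact measurable_measure_prodMk_left (ν := ν)
        ((measurable_fst.prodMk (hg.comp measurable_snd)) hA)
    · exact (continuous_finiteP m).comp (by fun_prop)

end Laws

/-! ### Uniform order statistics and exponential spacings -/

lemma ae_injective_pi (n : ℕ) : ∀ᵐ v : Fin n → ℝ, Function.Injective v := by
  have h : ∀ i j : Fin n, i ≠ j → ∀ᵐ v : Fin n → ℝ, v i ≠ v j := by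
    intro i j hij
    let p : Submodule ℝ (Fin n → ℝ) :=
      LinearMap.ker (LinearMap.proj (R := ℝ) (φ := fun _ : Fin n => ℝ) i - LinearMap.proj j)
    have hp : p ≠ ⊤ := by
      intro h
      have : (Pi.single i 1 : Fin n → ℝ) ∈ p := h ▸ Submodule.mem_top
      simp [p, hij.symm] at this
    have := Measure.addHaar_submodule (volume : Measure (Fin n → ℝ)) p hp
    rw [ae_iff]
    refine measure_mono_null (fun v hv => ?_) this
    simp only [ne_eq, not_not] at hv
    have hv' : v i = v j := hv
    simp [p, hv']
  have h' : ∀ᵐ v : Fin n → ℝ, ∀ i j : Fin n, i ≠ j → v i ≠ v j :=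
    ae_all_iff.2 fun i => ae_all_iff.2 fun j => by
      by_cases hij : i = j
      · simp [hij]
      · filter_upwards [h i j hij] with v hv _ using hv
  filter_upwards [h'] with v hv i j hij
  by_contra hne
  exact hv i j hne hij

lemma measurePreserving_comp_perm {n : ℕ} (σ : Equiv.Perm (Fin n)) :
    MeasurePreserving (fun v : Fin n → ℝ => v ∘ σ) := by
  have h := volume_measurePreserving_piCongrLeft (fun _ : Fin n => ℝ) σ.symm
  refine (congrArg (MeasurePreserving · volume volume) ?_).mpr h
  funext v i
  have := Equiv.piCongrLeft_apply_apply (fun _ : Fin n => ℝ) σ.symm v (σ i)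
  rw [Equiv.symm_apply_apply] at this
  exact this.symm

/-- The open simplex of increasing sequences in `(0, r)`. -/
def orderedSimplex (n : ℕ) (r : ℝ) : Set (Fin n → ℝ) :=
  {v | StrictMono v ∧ ∀ i, v i ∈ Set.Ioo 0 r}

lemma measurableSet_setOf_strictMono (n : ℕ) : MeasurableSet {v : Fin n → ℝ | StrictMono v} := by
  have : {v : Fin n → ℝ | StrictMono v} = ⋂ i, ⋂ j, {v | i < j → v i < v j} := by
    ext v
    simp only [Set.mem_iInter]
    rfl
  rw [this]
  refine MeasurableSet.iInter fun i => MeasurableSet.iInter fun j => ?_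
  by_cases hij : i < j
  · simp only [hij, true_imp_iff]
    exact measurableSet_lt (by fun_prop) (by fun_prop)
  · simp [hij]

lemma measurableSet_orderedSimplex (n : ℕ) (r : ℝ) : MeasurableSet (orderedSimplex n r) := by
  have : orderedSimplex n r = {v | StrictMono v} ∩ Set.univ.pi fun _ => Set.Ioo 0 r := by
    ext v; simp [orderedSimplex, Set.mem_pi]
  rw [this]
  exact (measurableSet_setOf_strictMono n).inter
    (MeasurableSet.univ_pi fun _ => measurableSet_Ioo)

/-- Up to a null set the cube is the disjoint union of the `n!` permuted copies of the ordered
simplex; sorting tells which copy contains a point. -/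
lemma lintegral_pi_uniform_eq {n : ℕ} {f : (Fin n → ℝ) → ENNReal} (hf : Measurable f)
    (hsymm : ∀ v (σ : Equiv.Perm (Fin n)), f (v ∘ σ) = f v) :
    ∫⁻ v, f v ∂(Measure.pi fun _ : Fin n => volume.restrict (Set.Ico (0 : ℝ) 1))
      = n.factorial * ∫⁻ v in orderedSimplex n 1, f v := by
  have hD := measurableSet_orderedSimplex n 1
  have hC : MeasurableSet (Set.univ.pi fun _ : Fin n => Set.Ioo (0 : ℝ) 1) :=
    MeasurableSet.univ_pi fun _ => measurableSet_Ioo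
  simp_rw [Measure.restrict_congr_set (Ioo_ae_eq_Ico (a := (0 : ℝ)) (b := 1) (μ := volume)).symm]
  rw [← Measure.restrict_pi_pi, ← volume_pi, ← lintegral_indicator hC]
  have h1 : ∀ᵐ v : Fin n → ℝ, (Set.univ.pi fun _ : Fin n => Set.Ioo (0 : ℝ) 1).indicator f v
      = ∑ σ : Equiv.Perm (Fin n), (orderedSimplex n 1).indicator f (v ∘ σ) := by
    filter_upwards [ae_injective_pi n] with v hv
    by_cases hvC : v ∈ Set.univ.pi fun _ : Fin n => Set.Ioo (0 : ℝ) 1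
    · have hsort : StrictMono (v ∘ Tuple.sort v) :=
        (Tuple.monotone_sort v).strictMono_of_injective (hv.comp (Tuple.sort v).injective)
      rw [Finset.sum_eq_single (Tuple.sort v), Set.indicator_of_mem hvC,
        Set.indicator_of_mem (show v ∘ Tuple.sort v ∈ orderedSimplex n 1 from
          ⟨hsort, fun i => hvC _ trivial⟩), hsymm]
      · intro τ _ hτ
        refine Set.indicator_of_notMem (fun hmem => hτ ?_) _
        have := Tuple.unique_monotone hmem.1.monotone (Tuple.monotone_sort v)
        ext i
        exact congrArg _ (hv (congrFun this i))
      · simp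
    · rw [Set.indicator_of_notMem hvC, Finset.sum_eq_zero]
      intro σ _
      refine Set.indicator_of_notMem (fun hmem => hvC fun i _ => ?_) _
      simpa using hmem.2 (σ.symm i)
  rw [lintegral_congr_ae h1, lintegral_finsetSum]
  swap
  · exact fun σ _ => (hf.indicator hD).comp (measurePreserving_comp_perm σ).measurable
  have h2 : ∀ σ : Equiv.Perm (Fin n), ∫⁻ v : Fin n → ℝ, (orderedSimplex n 1).indicator f (v ∘ σ)
      = ∫⁻ v in orderedSimplex n 1, f v := fun σ => by
    rw [(measurePreserving_comp_perm σ).lintegral_comp (hf.indicator hD), lintegral_indicator hD]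
  simp_rw [h2]
  simp [Fintype.card_perm]

/-! ### Partial sums of exponentials -/

lemma lintegral_pi_fin_succ {n : ℕ} (μ : Measure ℝ) [SigmaFinite μ] (i : Fin (n + 1))
    {f : (Fin (n + 1) → ℝ) → ENNReal} (hf : Measurable f) :
    ∫⁻ y, f y ∂(Measure.pi fun _ : Fin (n + 1) => μ)
      = ∫⁻ a, ∫⁻ y, f (i.insertNth a y) ∂(Measure.pi fun _ : Fin n => μ) ∂μ := by
  have h := (measurePreserving_piFinSuccAbove (fun _ : Fin (n + 1) => μ) i).symm
  rw [← h.lintegral_comp hf, lintegral_prod]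
  · rfl
  · exact (hf.comp (MeasurableEquiv.measurable _)).aemeasurable

lemma lintegral_pi_expMeasure_one {n : ℕ} {f : (Fin n → ℝ) → ENNReal} (hf : Measurable f) :
    ∫⁻ y, f y ∂(Measure.pi fun _ : Fin n => expMeasure 1)
      = ∫⁻ y in Set.univ.pi fun _ => Set.Ioi 0, ENNReal.ofReal (Real.exp (-∑ i, y i)) * f y := by
  induction n with
  | zero =>
    rw [volume_pi, Measure.restrict_pi_pi]
    rw [Measure.pi_of_empty, Measure.pi_of_empty]
    simp
  | succ n ih =>
    rw [lintegral_pi_fin_succ _ 0 hf, volume_pi, Measure.restrict_pi_pi,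
      lintegral_pi_fin_succ _ 0 (by fun_prop), lintegral_expMeasure_one]
    · refine lintegral_congr fun a => ?_
      rw [ih, volume_pi, ← Measure.restrict_pi_pi, ← lintegral_const_mul]
      · refine lintegral_congr fun y => ?_
        rw [← mul_assoc, ← ENNReal.ofReal_mul (Real.exp_pos _).le, ← Real.exp_add]
        congr 3
        rw [Fin.sum_univ_succ]
        simp
        ring
      · fun_prop
      · fun_prop
    · exact Measurable.lintegral_prod_right'
        (hf.comp (MeasurableEquiv.piFinSuccAbove (fun _ => ℝ) 0).symm.measurable)

/-- The partial sums of a finite sequence. -/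
def partialSums {n : ℕ} : (Fin n → ℝ) →ₗ[ℝ] (Fin n → ℝ) :=
  Matrix.toLin' (Matrix.of fun i j : Fin n => if j ≤ i then (1 : ℝ) else 0)

lemma partialSums_apply {n : ℕ} (y : Fin n → ℝ) (i : Fin n) :
    partialSums y i = ∑ j, if j ≤ i then y j else 0 := by
  simp [partialSums, Matrix.toLin'_apply, Matrix.mulVec, dotProduct]

/-- The matrix is triangular with ones on the diagonal. -/
lemma measurePreserving_partialSums (n : ℕ) :
    MeasurePreserving (partialSums : (Fin n → ℝ) →ₗ[ℝ] (Fin n → ℝ)) := by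
  refine ⟨(LinearMap.continuous_on_pi _).measurable, ?_⟩
  have hdet : (Matrix.of fun i j : Fin n => if j ≤ i then (1 : ℝ) else 0).det = 1 := by
    rw [Matrix.det_of_isLowerTriangular]
    · simp
    · intro i j hij
      have : i < j := hij
      simp [not_le.2 this]
  rw [partialSums, Real.map_matrix_volume_pi_eq_smul_volume_pi (by rw [hdet]; exact one_ne_zero),
    hdet]
  simp

lemma partialSums_zero {n : ℕ} (y : Fin (n + 1) → ℝ) : partialSums y 0 = y 0 := by
  rw [partialSums_apply, Finset.sum_eq_single 0]
  · simp
  · intro j _ hj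
    simp [hj]
  · simp

lemma partialSums_last {n : ℕ} (y : Fin (n + 1) → ℝ) : partialSums y (Fin.last n) = ∑ j, y j := by
  simp [partialSums_apply, Fin.le_last]

lemma partialSums_succ {n : ℕ} (y : Fin (n + 1) → ℝ) (i : Fin n) :
    partialSums y i.succ = partialSums y i.castSucc + y i.succ := by
  have h : ∀ j : Fin (n + 1), (if j ≤ i.succ then y j else 0)
      = (if j ≤ i.castSucc then y j else 0) + if j = i.succ then y j else 0 := by
    intro j
    have h1 : j = i.succ ↔ j.1 = i.1 + 1 := by rw [Fin.ext_iff, Fin.val_succ]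
    simp only [Fin.le_def, Fin.val_succ, Fin.val_castSucc, h1]
    split_ifs <;> first | omega | simp
  simp_rw [partialSums_apply, h, Finset.sum_add_distrib]
  simp

lemma partialSums_mem_iff {n : ℕ} (y : Fin (n + 1) → ℝ) :
    (StrictMono (partialSums y) ∧ 0 < partialSums y 0) ↔ ∀ i, 0 < y i := by
  rw [Fin.strictMono_iff_lt_succ, Fin.forall_fin_succ, partialSums_zero, and_comm]
  simp [partialSums_succ]

/-- The product density is the exponential of minus the total, so after the change of variables it
depends on the last partial sum only. -/
lemma lintegral_pi_exp_partialSums {n : ℕ} {g : (Fin (n + 1) → ℝ) → ENNReal} (hg : Measurable g) :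
    ∫⁻ y, g (partialSums y) ∂(Measure.pi fun _ : Fin (n + 1) => expMeasure 1)
      = ∫⁻ s in {s | StrictMono s ∧ 0 < s 0},
          ENNReal.ofReal (Real.exp (-s (Fin.last n))) * g s := by
  have hP := measurePreserving_partialSums (n + 1)
  have hS : MeasurableSet {s : Fin (n + 1) → ℝ | StrictMono s ∧ 0 < s 0} :=
    (measurableSet_setOf_strictMono _).inter
      (measurableSet_lt measurable_const (measurable_pi_apply 0))
  have hind : Measurable ({s : Fin (n + 1) → ℝ | StrictMono s ∧ 0 < s 0}.indicator fun s =>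
      ENNReal.ofReal (Real.exp (-s (Fin.last n))) * g s) := Measurable.indicator (by fun_prop) hS
  rw [lintegral_pi_expMeasure_one (f := fun y => g (partialSums y)) (hg.comp hP.measurable),
    ← lintegral_indicator (MeasurableSet.univ_pi fun _ => measurableSet_Ioi),
    ← lintegral_indicator hS, ← hP.lintegral_comp hind]
  refine lintegral_congr fun y => ?_
  by_cases hy : ∀ i, 0 < y i
  · rw [Set.indicator_of_mem (by simpa [Set.mem_pi] using hy), Set.indicator_of_mem
      (by exact (partialSums_mem_iff y).2 hy), partialSums_last]
  · rw [Set.indicator_of_notMem (by simpa [Set.mem_pi] using hy), Set.indicator_of_notMem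
      (by exact fun h => hy ((partialSums_mem_iff y).1 h))]

lemma strictMono_insertNth_last_iff {n : ℕ} (r : ℝ) (w : Fin n → ℝ) :
    (StrictMono ((Fin.last n).insertNth r w : Fin (n + 1) → ℝ)
      ∧ 0 < ((Fin.last n).insertNth r w : Fin (n + 1) → ℝ) 0) ↔ 0 < r ∧ w ∈ orderedSimplex n r := by
  rw [Fin.insertNth_last']
  have hc : ∀ i : Fin n, (Fin.snoc w r : Fin (n + 1) → ℝ) i.castSucc = w i :=
    fun i => Fin.snoc_castSucc (α := fun _ => ℝ) _ _ _
  have hl : (Fin.snoc w r : Fin (n + 1) → ℝ) (Fin.last n) = r :=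
    Fin.snoc_last (α := fun _ => ℝ) _ _
  constructor
  · rintro ⟨hm, h0⟩
    have hpos : ∀ k, 0 < (Fin.snoc w r : Fin (n + 1) → ℝ) k := fun k =>
      h0.trans_le (hm.monotone (Fin.zero_le k))
    refine ⟨hl ▸ hpos _, fun i j hij => ?_, fun i => ⟨hc i ▸ hpos _, ?_⟩⟩
    · rw [← hc i, ← hc j]
      exact hm (Fin.castSucc_lt_castSucc_iff.2 hij)
    · rw [← hc i]
      nth_rewrite 2 [← hl]
      exact hm (Fin.castSucc_lt_last i)
  · rintro ⟨hr, hm, hw⟩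
    constructor
    · intro a b
      refine Fin.lastCases ?_ (fun i => ?_) a <;> refine Fin.lastCases ?_ (fun j => ?_) b
      · simp
      · intro h
        exact absurd h (not_lt.2 (Fin.le_last _))
      · intro _
        rw [hc, hl]
        exact (hw i).2
      · intro h
        rw [hc, hc]
        exact hm (Fin.castSucc_lt_castSucc_iff.1 h)
    · refine Fin.lastCases (motive := fun k => 0 < (Fin.snoc w r : Fin (n + 1) → ℝ) k) ?_ ?_ 0
      · rw [hl]; exact hr
      · intro i
        rw [hc]; exact (hw i).1

lemma smul_mem_orderedSimplex_iff {n : ℕ} {r : ℝ} (hr : 0 < r) (w : Fin n → ℝ) :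
    r⁻¹ • w ∈ orderedSimplex n 1 ↔ w ∈ orderedSimplex n r := by
  have h1 : StrictMono (r⁻¹ • w) ↔ StrictMono w :=
    ⟨fun h i j hij => by simpa [inv_pos.2 hr] using h hij,
      fun h i j hij => by simpa [inv_pos.2 hr] using h hij⟩
  simp only [orderedSimplex, Set.mem_ofPred_eq, h1, Set.mem_Ioo, Pi.smul_apply, smul_eq_mul]
  refine and_congr_right fun _ => forall_congr' fun i => ?_
  rw [inv_mul_lt_iff₀ hr, mul_one]
  simp [hr]

lemma setLIntegral_orderedSimplex_smul {n : ℕ} {r : ℝ} (hr : 0 < r) {f : (Fin n → ℝ) → ENNReal}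
    (hf : Measurable f) :
    ∫⁻ w in orderedSimplex n r, f (r⁻¹ • w)
      = ENNReal.ofReal (r ^ n) * ∫⁻ v in orderedSimplex n 1, f v := by
  have hm := Measure.map_addHaar_smul (volume : Measure (Fin n → ℝ)) (inv_pos.2 hr).ne'
  have hi := hf.indicator (measurableSet_orderedSimplex n 1)
  have h := lintegral_map hi (g := fun w : Fin n → ℝ => r⁻¹ • w) (μ := volume) (by fun_prop)
  rw [← lintegral_indicator (measurableSet_orderedSimplex n r),
    ← lintegral_indicator (measurableSet_orderedSimplex n 1)]
  have e : ∀ w, (orderedSimplex n r).indicator (fun w => f (r⁻¹ • w)) w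
      = (orderedSimplex n 1).indicator f (r⁻¹ • w) := by
    intro w
    by_cases hw : w ∈ orderedSimplex n r
    · rw [Set.indicator_of_mem hw, Set.indicator_of_mem ((smul_mem_orderedSimplex_iff hr w).2 hw)]
    · rw [Set.indicator_of_notMem hw,
        Set.indicator_of_notMem fun h => hw ((smul_mem_orderedSimplex_iff hr w).1 h)]
  simp_rw [e]
  rw [← h]
  erw [hm]
  rw [lintegral_smul_measure, smul_eq_mul]
  congr 2
  simp [abs_of_pos hr]

/-- The normalized partial sums `S_1 / S_{n+1}, …, S_n / S_{n+1}`. -/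
noncomputable def normalizedSums {n : ℕ} (y : Fin (n + 1) → ℝ) (i : Fin n) : ℝ :=
  partialSums y i.castSucc / partialSums y (Fin.last n)

lemma measurable_normalizedSums {n : ℕ} :
    Measurable (normalizedSums : (Fin (n + 1) → ℝ) → Fin n → ℝ) := by
  have hP := (measurePreserving_partialSums (n + 1)).measurable
  refine measurable_pi_iff.2 fun i => ?_
  exact ((measurable_pi_apply _).comp hP).div ((measurable_pi_apply _).comp hP)

/-- For a fixed total `r` the earlier partial sums are uniform on the ordered simplex of size `r`;
rescaling it to size `1` costs `r ^ n` and separates the integrals. -/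
lemma lintegral_pi_exp_normalizedSums {n : ℕ} {f : (Fin n → ℝ) → ENNReal} (hf : Measurable f) :
    ∫⁻ y, f (normalizedSums y) ∂(Measure.pi fun _ : Fin (n + 1) => expMeasure 1)
      = (∫⁻ r in Set.Ioi (0 : ℝ), ENNReal.ofReal (Real.exp (-r)) * ENNReal.ofReal (r ^ n))
        * ∫⁻ v in orderedSimplex n 1, f v := by
  have hS : MeasurableSet {s : Fin (n + 1) → ℝ | StrictMono s ∧ 0 < s 0} :=
    (measurableSet_setOf_strictMono _).inter
      (measurableSet_lt measurable_const (measurable_pi_apply 0))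
  have hg : Measurable fun s : Fin (n + 1) → ℝ => f fun i => s i.castSucc / s (Fin.last n) :=
    hf.comp (measurable_pi_iff.2 fun i => by fun_prop)
  have h1 := lintegral_pi_exp_partialSums hg
  have h2 : Measurable ({s : Fin (n + 1) → ℝ | StrictMono s ∧ 0 < s 0}.indicator fun s =>
      ENNReal.ofReal (Real.exp (-s (Fin.last n))) * f fun i => s i.castSucc / s (Fin.last n)) :=
    Measurable.indicator (by fun_prop) hS
  refine h1.trans ?_
  rw [← lintegral_indicator hS, volume_pi, lintegral_pi_fin_succ _ (Fin.last n) h2,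
    ← lintegral_mul_const _ (by fun_prop), ← lintegral_indicator measurableSet_Ioi]
  refine lintegral_congr fun r => ?_
  by_cases hr : 0 < r
  · rw [Set.indicator_of_mem (Set.mem_Ioi.2 hr), mul_assoc,
      ← setLIntegral_orderedSimplex_smul hr hf, ← volume_pi,
      ← lintegral_const_mul _ (by fun_prop),
      ← lintegral_indicator (measurableSet_orderedSimplex n r)]
    refine lintegral_congr fun w => ?_
    have hiff := strictMono_insertNth_last_iff r w
    by_cases hw : w ∈ orderedSimplex n r
    · rw [Set.indicator_of_mem hw, Set.indicator_of_mem (by exact hiff.2 ⟨hr, hw⟩)]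
      congr 2
      · simp
      · funext i
        have : (Fin.last n).succAbove i = i.castSucc := Fin.succAbove_last_apply i
        rw [← this]
        simp [div_eq_inv_mul]
    · rw [Set.indicator_of_notMem hw, Set.indicator_of_notMem (by exact fun h => hw (hiff.1 h).2)]
  · rw [Set.indicator_of_notMem (by simpa using hr)]
    refine lintegral_eq_zero_of_ae_eq_zero (Eventually.of_forall fun w => ?_)
    exact Set.indicator_of_notMem
      (by exact fun h => hr ((strictMono_insertNth_last_iff r w).1 h).1) _

/-- A symmetric functional of uniform variables has the same mean as that functional of the
normalized partial sums of exponential variables. -/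
lemma lintegral_pi_uniform_eq_lintegral_pi_exp {n : ℕ} {f : (Fin n → ℝ) → ENNReal}
    (hf : Measurable f) (hsymm : ∀ v (σ : Equiv.Perm (Fin n)), f (v ∘ σ) = f v) :
    ∫⁻ v, f v ∂(Measure.pi fun _ : Fin n => volume.restrict (Set.Ico (0 : ℝ) 1))
      = ∫⁻ y, f (normalizedSums y) ∂(Measure.pi fun _ : Fin (n + 1) => expMeasure 1) := by
  have : IsProbabilityMeasure (volume.restrict (Set.Ico (0 : ℝ) 1)) := ⟨by simp⟩
  -- Total masses give `n! * V = 1 = K * V`, so the two constants agree without evaluating the Gamma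
  -- integral.
  have h1 := lintegral_pi_uniform_eq (n := n) (f := fun _ => 1) measurable_const fun _ _ => rfl
  have h2 := lintegral_pi_exp_normalizedSums (n := n) (f := fun _ => 1) measurable_const
  simp only [lintegral_one, measure_univ] at h1 h2
  rw [lintegral_pi_uniform_eq hf hsymm, lintegral_pi_exp_normalizedSums hf]
  congr 1
  set K := ∫⁻ r in Set.Ioi (0 : ℝ), ENNReal.ofReal (Real.exp (-r)) * ENNReal.ofReal (r ^ n)
  set V := (volume.restrict (orderedSimplex n 1)) Set.univ
  calc (n.factorial : ENNReal) = n.factorial * (K * V) := by rw [← h2, mul_one]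
    _ = K * (n.factorial * V) := by ring
    _ = K := by rw [← h1, mul_one]

/-! ### Limit laws and almost sure convergence -/

/-- The sequences `x` with `sup_k (x_k - (x_0 + ⋯ + x_{k-1})) ≤ t`. -/
def gapSet (t : ℝ) : Set (ℕ → ℝ) := {x | ∀ k, x k ≤ ∑ i ∈ Finset.range k, x i + t}

/-- The sequences `x` for which all partial sums of `∑ x_j / (2 ^ j - 1)` are at most `t`. -/
def jSet (t : ℝ) : Set (ℕ → ℝ) := {x | ∀ m, ∑ j ∈ Finset.range m, jTerm x j ≤ t}

lemma measurable_jTerm (j : ℕ) : Measurable fun x => jTerm x j := by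
  unfold jTerm
  fun_prop

lemma measurableSet_gapSet (t : ℝ) : MeasurableSet (gapSet t) := by
  have : gapSet t = ⋂ k, {x | x k ≤ ∑ i ∈ Finset.range k, x i + t} := by
    ext x; simp [gapSet]
  rw [this]
  exact MeasurableSet.iInter fun k => measurableSet_le (by fun_prop) (by fun_prop)

lemma measurableSet_jSet (t : ℝ) : MeasurableSet (jSet t) := by
  have : jSet t = ⋂ m, {x | ∑ j ∈ Finset.range m, jTerm x j ≤ t} := by
    ext x; simp [jSet]
  rw [this]
  exact MeasurableSet.iInter fun m => measurableSet_le
    (Finset.measurable_sum _ fun j _ => measurable_jTerm j) measurable_const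

lemma integral_expMeasure_one :
    Integrable (fun x : ℝ => x) (expMeasure 1) ∧ ∫ x, x ∂expMeasure 1 = 1 := by
  have hpos : ∀ᵐ x ∂expMeasure 1, 0 ≤ x := by
    have : expMeasure 1 (Set.Iio 0) = 0 := by
      rw [← lintegral_indicator_one measurableSet_Iio,
        lintegral_expMeasure_one (measurable_one.indicator measurableSet_Iio)]
      refine setLIntegral_eq_zero measurableSet_Ioi fun x hx => ?_
      simp [le_of_lt (Set.mem_Ioi.1 hx)]
    rw [ae_iff]
    convert this using 2
    ext x; simp
  have hG : ∫ x in Set.Ioi (0 : ℝ), Real.exp (-x) * x = 1 := by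
    have := Real.Gamma_eq_integral (s := 2) (by norm_num)
    rw [Real.Gamma_two] at this
    rw [this]
    refine setIntegral_congr_fun measurableSet_Ioi fun x _ => ?_
    norm_num
  have hI : IntegrableOn (fun x => Real.exp (-x) * x) (Set.Ioi (0 : ℝ)) := by
    refine (Real.GammaIntegral_convergent (s := 2) (by norm_num)).congr_fun (fun x _ => ?_)
      measurableSet_Ioi
    norm_num
  have hL : ∫⁻ x, ENNReal.ofReal x ∂expMeasure 1 = 1 := by
    rw [lintegral_expMeasure_one (by fun_prop)]
    simp_rw [← ENNReal.ofReal_mul (Real.exp_pos _).le]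
    rw [← ofReal_integral_eq_lintegral_ofReal hI, hG, ENNReal.ofReal_one]
    refine (ae_restrict_iff' measurableSet_Ioi).2 (Eventually.of_forall fun x hx => ?_)
    exact mul_nonneg (Real.exp_pos _).le (le_of_lt hx)
  constructor
  · rw [← lintegral_ofReal_ne_top_iff_integrable (by fun_prop) hpos, hL]
    exact ENNReal.one_ne_top
  · rw [integral_eq_lintegral_of_nonneg_ae hpos (by fun_prop), hL, ENNReal.toReal_one]

section

variable {Ω : Type*} [MeasurableSpace Ω] {ν : Measure Ω}

lemma IsIIDExp.ae_tendsto_mean {Y : ℕ → Ω → ℝ} (hY : IsIIDExp Y ν) :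
    ∀ᵐ ω ∂ν, Tendsto (fun k : ℕ => (∑ i ∈ Finset.range k, Y i ω) / k) atTop (𝓝 1) := by
  have hint : Integrable (Y 0) ν := by
    have h := integral_expMeasure_one.1
    rw [← (hY.hasLaw 0).map_eq] at h
    exact h.comp_measurable (hY.measurable 0)
  have hE : ∫ ω, Y 0 ω ∂ν = 1 := by
    rw [(hY.hasLaw 0).integral_eq, integral_expMeasure_one.2]
  have := strong_law_ae_real Y hint (fun i j hij => hY.indep.indepFun hij)
    fun i => ⟨(hY.measurable i).aemeasurable, (hY.measurable 0).aemeasurable,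
      by rw [(hY.hasLaw i).map_eq, (hY.hasLaw 0).map_eq]⟩
  rwa [hE] at this

lemma measureReal_iInter_eq_limitP [IsProbabilityMeasure ν] {s : ℕ → Set Ω}
    (hs : ∀ m, MeasurableSet (s m))
    (hanti : Antitone s) {t : ℝ} (ht : 0 ≤ t) (h : ∀ m, ν.real (s m) = finiteP m t) :
    ν.real (⋂ m, s m) = limitP t := by
  have h1 := tendsto_measure_iInter_atTop (μ := ν) (fun m => (hs m).nullMeasurableSet) hanti
    ⟨0, measure_ne_top _ _⟩
  have h2 := (ENNReal.tendsto_toReal (measure_ne_top ν _)).comp h1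
  refine tendsto_nhds_unique h2 ?_
  refine (tendsto_finiteP ht).congr fun m => ?_
  rw [← h m]; rfl

lemma IsIIDExp.measureReal_gapSet [IsProbabilityMeasure ν] {Y : ℕ → Ω → ℝ} (hY : IsIIDExp Y ν)
    {t : ℝ} (ht : 0 ≤ t) :
    ν.real {ω | (fun k => Y k ω) ∈ gapSet t} = limitP t := by
  have e : {ω | (fun k => Y k ω) ∈ gapSet t}
      = ⋂ m, {ω | ∀ k < m, Y k ω ≤ ∑ i ∈ Finset.range k, Y i ω + t} := by
    ext ω
    simp only [gapSet, Set.mem_ofPred_eq, Set.mem_iInter]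
    exact ⟨fun h m k _ => h k, fun h k => h (k + 1) k (Nat.lt_succ_self k)⟩
  rw [e]
  refine measureReal_iInter_eq_limitP (fun m => ?_) (fun m m' hm => ?_) ht
    fun m => measureReal_forall_le_sum m hY ht
  · have hm := hY.measurable
    have : {ω | ∀ k < m, Y k ω ≤ ∑ i ∈ Finset.range k, Y i ω + t}
        = ⋂ k ∈ Set.Iio m, {ω | Y k ω ≤ ∑ i ∈ Finset.range k, Y i ω + t} := by
      ext ω; simp
    rw [this]
    exact MeasurableSet.biInter (Set.to_countable _) fun k _ =>
      measurableSet_le (hm k) (by fun_prop)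
  · exact Set.ofPred_subset_ofPred.2 fun ω hω k hk => hω k (lt_of_lt_of_le hk hm)

lemma IsIIDExp.measureReal_jSet [IsProbabilityMeasure ν] {Y : ℕ → Ω → ℝ} (hY : IsIIDExp Y ν)
    {t : ℝ} (ht : 0 ≤ t) :
    ν.real {ω | (fun k => Y k ω) ∈ jSet t} = limitP t := by
  have hm : Measurable fun ω k => Y k ω := measurable_pi_iff.2 hY.measurable
  have e : {ω | (fun k => Y k ω) ∈ jSet t}
      = ⋂ m, {ω | ∑ j ∈ Finset.range m, jTerm (fun j => Y j ω) j ≤ t} := by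
    ext ω
    simp [jSet]
  rw [e]
  refine measureReal_iInter_eq_limitP (fun m => ?_) (fun m m' hm => ?_) ht
    fun m => measureReal_sum_jTerm_le m hY ht
  · exact measurableSet_le (Finset.measurable_sum _ fun j _ => (measurable_jTerm j).comp hm)
      measurable_const
  · refine Set.ofPred_subset_ofPred.2 fun ω hω => le_trans ?_ hω
    exact Finset.sum_le_sum_of_subset_of_nonneg (Finset.range_mono hm)
      fun j _ _ => div_nonneg (hY.pos j ω).le (two_pow_succ_sub_one_pos j).le

lemma IsIIDExp.measureReal_inter {Y : ℕ ⊕ ℕ → Ω → ℝ} (hY : IsIIDExp Y ν) {A B : Set (ℕ → ℝ)}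
    (hA : MeasurableSet A) (hB : MeasurableSet B) :
    ν.real ({ω | (fun k => Y (.inl k) ω) ∈ A} ∩ {ω | (fun k => Y (.inr k) ω) ∈ B})
      = ν.real {ω | (fun k => Y (.inl k) ω) ∈ A} * ν.real {ω | (fun k => Y (.inr k) ω) ∈ B} := by
  have hd : Disjoint (Set.range (Sum.inl : ℕ → ℕ ⊕ ℕ)) (Set.range Sum.inr) := by
    rw [Set.disjoint_left]
    rintro _ ⟨_, rfl⟩ ⟨k, hk⟩
    cases hk
  have h := indepFun_comp_of_disjoint_range hY.measurable hY.indep _ _ hd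
  simp only [measureReal_def, ← ENNReal.toReal_mul]
  congr 1
  exact h.measure_inter_preimage_eq_mul A B hA hB

end

/-! Deterministic sequences whose partial sums grow linearly. -/

/-- Two-sided bounds on consecutive partial sums give `a k ≤ 11/10 * (k + 1) - 9/10 * k = 11/10 + k
/ 5` for large `k`. What matters is that the slope `1/5` is smaller than `9/10`. -/
lemma exists_linear_bounds {a : ℕ → ℝ} (ha : ∀ k, 0 < a k)
    (hlim : Tendsto (fun k : ℕ => (∑ i ∈ Finset.range k, a i) / k) atTop (𝓝 1)) :
    ∃ C : ℝ, 0 ≤ C ∧ (∀ k, a k ≤ C + k / 5) ∧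
      (∀ k, a k - ∑ i ∈ Finset.range k, a i ≤ C) ∧
      ∀ᶠ k : ℕ in atTop, 9 / 10 * (k : ℝ) ≤ ∑ i ∈ Finset.range k, a i := by
  have h1 : ∀ᶠ k : ℕ in atTop, 9 / 10 * (k : ℝ) ≤ ∑ i ∈ Finset.range k, a i ∧
      ∑ i ∈ Finset.range k, a i ≤ 11 / 10 * (k : ℝ) := by
    filter_upwards [hlim.eventually (Icc_mem_nhds (show (9 / 10 : ℝ) < 1 by norm_num)
      (show (1 : ℝ) < 11 / 10 by norm_num)), eventually_gt_atTop 0] with k hk hk0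
    have hk0' : (0 : ℝ) < k := by exact_mod_cast hk0
    exact ⟨(le_div_iff₀ hk0').1 hk.1, (div_le_iff₀ hk0').1 hk.2⟩
  obtain ⟨K, hK⟩ := eventually_atTop.1 h1
  have hS : ∀ k, 0 ≤ ∑ i ∈ Finset.range k, a i := fun k => Finset.sum_nonneg fun i _ => (ha i).le
  have hsmall : ∀ k < K, a k ≤ ∑ i ∈ Finset.range K, a i := fun k hk =>
    Finset.single_le_sum (fun i _ => (ha i).le) (Finset.mem_range.2 hk)
  have hlarge : ∀ k, K ≤ k → a k ≤ 11 / 10 + k / 5 := by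
    intro k hk
    have a1 := (hK k hk).1
    have a2 := (hK (k + 1) (by omega)).2
    rw [Finset.sum_range_succ] at a2
    push_cast at a2
    linarith
  refine ⟨∑ i ∈ Finset.range K, a i + 11 / 10, by linarith [hS K], fun k => ?_, fun k => ?_,
    h1.mono fun k hk => hk.1⟩
  · have hk0 : (0 : ℝ) ≤ k := Nat.cast_nonneg k
    rcases lt_or_ge k K with h | h
    · linarith [hsmall k h]
    · linarith [hlarge k h, hS K]
  · have hk0 : (0 : ℝ) ≤ k := Nat.cast_nonneg k
    rcases lt_or_ge k K with h | h
    · linarith [hsmall k h, hS k]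
    · linarith [hlarge k h, hS K, (hK k h).1]

lemma summable_jTerm {a : ℕ → ℝ} (ha : ∀ k, 0 < a k)
    (hlim : Tendsto (fun k : ℕ => (∑ i ∈ Finset.range k, a i) / k) atTop (𝓝 1)) :
    Summable (jTerm a) := by
  obtain ⟨C, hC, hb, -, -⟩ := exists_linear_bounds ha hlim
  have h1 : Summable fun k : ℕ => C * (1 / 2 : ℝ) ^ k + (k : ℝ) ^ 1 * (1 / 2 : ℝ) ^ k :=
    (summable_geometric_two.mul_left C).add
      (summable_pow_mul_geometric_of_norm_lt_one 1 (by norm_num))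
  refine Summable.of_nonneg_of_le
    (fun j => div_nonneg (ha j).le (two_pow_succ_sub_one_pos j).le) (fun j => ?_) h1
  have h2 : (2 : ℝ) ^ j ≤ 2 ^ (j + 1) - 1 := by
    have : (1 : ℝ) ≤ 2 ^ j := one_le_pow₀ one_le_two
    rw [pow_succ]; linarith
  have hj : (0 : ℝ) ≤ j := Nat.cast_nonneg j
  calc jTerm a j ≤ (C + j) / 2 ^ j := by
        refine div_le_div₀ (by linarith) (by linarith [hb j]) (by positivity) h2
    _ = _ := by rw [one_div, inv_pow]; ring

/-- `sup_k (a_k - (a_0 + ⋯ + a_{k-1}))` -/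
noncomputable def maxGap (a : ℕ → ℝ) : ℝ := ⨆ k, (a k - ∑ i ∈ Finset.range k, a i)

/-- Needed because the real supremum in `maxGap` has the default value `0` on unbounded sets. -/
lemma bddAbove_gaps {a : ℕ → ℝ} (ha : ∀ k, 0 < a k)
    (hlim : Tendsto (fun k : ℕ => (∑ i ∈ Finset.range k, a i) / k) atTop (𝓝 1)) :
    BddAbove (Set.range fun k => a k - ∑ i ∈ Finset.range k, a i) := by
  obtain ⟨C, -, -, hb, -⟩ := exists_linear_bounds ha hlim
  exact ⟨C, by rintro _ ⟨k, rfl⟩; exact hb k⟩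

lemma maxGap_le_iff {a : ℕ → ℝ} (ha : ∀ k, 0 < a k)
    (hlim : Tendsto (fun k : ℕ => (∑ i ∈ Finset.range k, a i) / k) atTop (𝓝 1)) (t : ℝ) :
    maxGap a ≤ t ↔ a ∈ gapSet t := by
  rw [maxGap, ciSup_le_iff (bddAbove_gaps ha hlim)]
  simp only [gapSet, Set.mem_ofPred_eq, sub_le_iff_le_add, add_comm]

lemma gap_le_maxGap {a : ℕ → ℝ} (ha : ∀ k, 0 < a k)
    (hlim : Tendsto (fun k : ℕ => (∑ i ∈ Finset.range k, a i) / k) atTop (𝓝 1)) (k : ℕ) :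
    a k - ∑ i ∈ Finset.range k, a i ≤ maxGap a :=
  le_ciSup (bddAbove_gaps ha hlim) k

lemma maxGap_pos {a : ℕ → ℝ} (ha : ∀ k, 0 < a k)
    (hlim : Tendsto (fun k : ℕ => (∑ i ∈ Finset.range k, a i) / k) atTop (𝓝 1)) :
    0 < maxGap a := by
  refine (ha 0).trans_le ?_
  have := gap_le_maxGap ha hlim 0
  rwa [Finset.sum_range_zero, sub_zero] at this

lemma tsum_jTerm_le_iff {a : ℕ → ℝ} (ha : ∀ k, 0 < a k)
    (hlim : Tendsto (fun k : ℕ => (∑ i ∈ Finset.range k, a i) / k) atTop (𝓝 1)) (t : ℝ) :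
    ∑' j, jTerm a j ≤ t ↔ a ∈ jSet t := by
  have hs := summable_jTerm ha hlim
  have h0 : ∀ j, 0 ≤ jTerm a j := fun j => div_nonneg (ha j).le (two_pow_succ_sub_one_pos j).le
  exact ⟨fun h m => (hs.sum_le_tsum _ fun j _ => h0 j).trans h,
    fun h => Real.tsum_le_of_sum_range_le h0 h⟩

/-- The spacings formed by a beginning of `a` from the left and one of `b` from the right. -/
def spacing (a b : ℕ → ℝ) (n i : ℕ) : ℝ := if i < (n + 1) / 2 then a i else b (n - i)

lemma sum_spacing_left (a b : ℕ → ℝ) {n k : ℕ} (hk : k ≤ (n + 1) / 2) :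
    ∑ i ∈ Finset.range k, spacing a b n i = ∑ i ∈ Finset.range k, a i :=
  Finset.sum_congr rfl fun i hi => if_pos (by have := Finset.mem_range.1 hi; omega)

lemma sum_spacing_add_right (a b : ℕ → ℝ) {n k : ℕ} (hk : (n + 1) / 2 ≤ k) (hkn : k ≤ n + 1) :
    ∑ i ∈ Finset.range k, spacing a b n i + ∑ i ∈ Finset.range (n + 1 - k), b i
      = ∑ i ∈ Finset.range ((n + 1) / 2), a i
        + ∑ i ∈ Finset.range (n + 1 - (n + 1) / 2), b i := by
  induction k, hk using Nat.le_induction with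
  | base => rw [sum_spacing_left a b le_rfl]
  | succ k hk ih =>
    rw [← ih (by omega), Finset.sum_range_succ, show n + 1 - k = (n + 1 - (k + 1)) + 1 by omega,
      Finset.sum_range_succ, spacing, if_neg (by omega), show n + 1 - (k + 1) = n - k by omega]
    ring

lemma sum_spacing_total (a b : ℕ → ℝ) (n : ℕ) :
    ∑ i ∈ Finset.range (n + 1), spacing a b n i
      = ∑ i ∈ Finset.range ((n + 1) / 2), a i
        + ∑ i ∈ Finset.range (n + 1 - (n + 1) / 2), b i := by
  have := sum_spacing_add_right a b (n := n) (k := n + 1) (by omega) le_rfl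
  simpa using this

/-- The scaled saving `(n + 1) (1 - T)` for the positions with given spacings. -/
noncomputable def scaledSaving (w : ℕ → ℝ) (n : ℕ) : ℝ :=
  ((n : ℝ) + 1) * (1 - minTravelTime fun i : Fin n =>
    (((∑ j ∈ Finset.range (i + 1), w j) / ∑ j ∈ Finset.range (n + 1), w j : ℝ) : UnitAddCircle))

/-- This is `lt_minTravelTime_iff` multiplied by the total of the spacings; the factor of `t` on the
right is their mean, which will tend to `1`. -/
lemma scaledSaving_lt_iff {w : ℕ → ℝ} (hw : ∀ i, 0 < w i) (n : ℕ) (t : ℝ) :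
    scaledSaving w n < t ↔ ∀ k ≤ n,
      w k - ∑ j ∈ Finset.range k, w j < t * ((∑ j ∈ Finset.range (n + 1), w j) / (n + 1)) ∧
      w k - (∑ j ∈ Finset.range (n + 1), w j - ∑ j ∈ Finset.range (k + 1), w j)
        < t * ((∑ j ∈ Finset.range (n + 1), w j) / (n + 1)) := by
  have hn : (0 : ℝ) < n + 1 := by positivity
  have hN : 0 < ∑ j ∈ Finset.range (n + 1), w j :=
    Finset.sum_pos (fun i _ => hw i) ⟨0, by simp⟩
  set N := ∑ j ∈ Finset.range (n + 1), w j with hNdef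
  have hv : Monotone fun k : ℕ => (∑ j ∈ Finset.range k, w j) / N := fun k l hkl =>
    div_le_div_of_nonneg_right (Finset.sum_le_sum_of_subset_of_nonneg (Finset.range_mono hkl)
      fun i _ _ => (hw i).le) hN.le
  have h := lt_minTravelTime_iff (n := n) _ hv (by simp) (by simp only [← hNdef]; exact div_self hN.ne')
    (t / (n + 1))
  have e1 : scaledSaving w n < t ↔ 1 - t / (n + 1) < minTravelTime fun i : Fin n =>
      (((∑ j ∈ Finset.range (i + 1), w j) / N : ℝ) : UnitAddCircle) := by
    rw [scaledSaving, ← hNdef, mul_comm, ← lt_div_iff₀ hn]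
    constructor <;> intro h <;> linarith
  rw [e1, h]
  refine forall₂_congr fun k _ => and_congr ?_ ?_
  · rw [← mul_lt_mul_iff_left₀ hN, show t * (N / (n + 1)) = t / (n + 1) * N by ring]
    rw [Finset.sum_range_succ]
    have : ((∑ j ∈ Finset.range k, w j + w k) / N - 2 * ((∑ j ∈ Finset.range k, w j) / N)) * N
        = w k - ∑ j ∈ Finset.range k, w j := by field_simp; ring
    rw [this]
  · rw [← mul_lt_mul_iff_left₀ hN, show t * (N / (n + 1)) = t / (n + 1) * N by ring]
    rw [Finset.sum_range_succ]
    have : (2 * ((∑ j ∈ Finset.range k, w j + w k) / N)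
        - (∑ j ∈ Finset.range k, w j) / N - 1) * N
        = w k - (N - (∑ j ∈ Finset.range k, w j + w k)) := by field_simp; ring
    rw [this]

/-! ### Convergence of the scaled savings for fixed sequences -/

lemma spacing_pos {a b : ℕ → ℝ} (ha : ∀ k, 0 < a k) (hb : ∀ k, 0 < b k) (n i : ℕ) :
    0 < spacing a b n i := by
  rw [spacing]
  split_ifs
  exacts [ha i, hb _]

lemma forall_gaps_lt_of_scaledSaving_lt {a b : ℕ → ℝ} (ha : ∀ k, 0 < a k) (hb : ∀ k, 0 < b k)
    {n : ℕ} {t : ℝ} (h : scaledSaving (spacing a b n) n < t) :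
    let r := (∑ j ∈ Finset.range (n + 1), spacing a b n j) / (n + 1)
    (∀ k < (n + 1) / 2, a k - ∑ i ∈ Finset.range k, a i < t * r) ∧
      ∀ k < (n + 1) / 2, b k - ∑ i ∈ Finset.range k, b i < t * r := by
  intro r
  rw [scaledSaving_lt_iff (spacing_pos ha hb n)] at h
  constructor
  · intro k hk
    have := (h k (by omega)).1
    rwa [sum_spacing_left a b hk.le, spacing, if_pos hk] at this
  · intro k hk
    have h1 := (h (n - k) (by omega)).2
    have h2 := sum_spacing_add_right a b (n := n) (k := n - k + 1) (by omega) (by omega)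
    rw [← sum_spacing_total, show n + 1 - (n - k + 1) = k by omega] at h2
    rw [spacing, if_neg (by omega), show n - (n - k) = k by omega] at h1
    linarith

/-- In `h3` and `h4` a gap of one half is reached from the far side, where the arc contains the
whole other half. -/
lemma scaledSaving_lt_of_forall_gaps_lt {a b : ℕ → ℝ} (ha : ∀ k, 0 < a k) (hb : ∀ k, 0 < b k)
    {n : ℕ} {t c : ℝ}
    (hc : c ≤ t * ((∑ j ∈ Finset.range (n + 1), spacing a b n j) / (n + 1)))
    (h1 : ∀ k, a k - ∑ i ∈ Finset.range k, a i < c)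
    (h2 : ∀ k, b k - ∑ i ∈ Finset.range k, b i < c)
    (h3 : ∀ k < (n + 1) / 2, a k - ∑ i ∈ Finset.range (n + 1 - (n + 1) / 2), b i < c)
    (h4 : ∀ k < n + 1 - (n + 1) / 2, b k - ∑ i ∈ Finset.range ((n + 1) / 2), a i < c) :
    scaledSaving (spacing a b n) n < t := by
  rw [scaledSaving_lt_iff (spacing_pos ha hb n)]
  intro k hk
  rcases lt_or_ge k ((n + 1) / 2) with h | h
  · have e := sum_spacing_total a b n
    have hle : ∑ i ∈ Finset.range (k + 1), a i ≤ ∑ i ∈ Finset.range ((n + 1) / 2), a i :=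
      Finset.sum_le_sum_of_subset_of_nonneg (Finset.range_mono h) fun i _ _ => (ha i).le
    have hs : spacing a b n k = a k := if_pos h
    have e1 := sum_spacing_left a b (n := n) h.le
    have e2 := sum_spacing_left a b (n := n) (k := k + 1) h
    constructor
    · linarith [h1 k]
    · linarith [h3 k h]
  · have hs : spacing a b n k = b (n - k) := if_neg (by omega)
    have e := sum_spacing_add_right a b (n := n) (k := k + 1) (by omega) (by omega)
    rw [← sum_spacing_total, show n + 1 - (k + 1) = n - k by omega] at e
    have hle : ∑ i ∈ Finset.range ((n + 1) / 2), a i ≤ ∑ i ∈ Finset.range k, spacing a b n i := by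
      rw [← sum_spacing_left a b le_rfl]
      exact Finset.sum_le_sum_of_subset_of_nonneg (Finset.range_mono h)
        fun i _ _ => (spacing_pos ha hb n i).le
    constructor
    · linarith [h4 (n - k) (by omega)]
    · linarith [h2 (n - k)]

lemma tendsto_sum_sub_div {a : ℕ → ℝ}
    (hlim : Tendsto (fun k : ℕ => (∑ i ∈ Finset.range k, a i) / k) atTop (𝓝 1)) {h : ℕ → ℕ}
    (hh : Tendsto h atTop atTop) (hle : ∀ n, h n ≤ n + 1) :
    Tendsto (fun n : ℕ => (∑ i ∈ Finset.range (h n), a i - h n) / ((n : ℝ) + 1)) atTop (𝓝 0) := by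
  have h1 := (hlim.comp hh).sub_const 1
  rw [sub_self] at h1
  rw [tendsto_zero_iff_norm_tendsto_zero] at h1
  refine squeeze_zero_norm' ?_ h1
  filter_upwards [hh.eventually_gt_atTop 0] with n hn
  have hn' : (0 : ℝ) < h n := by exact_mod_cast hn
  have hle' : (h n : ℝ) ≤ n + 1 := by exact_mod_cast hle n
  have e : (∑ i ∈ Finset.range (h n), a i) / (h n) - 1
      = (∑ i ∈ Finset.range (h n), a i - h n) / h n := by field_simp
  simp only [Function.comp, e, norm_div]
  refine div_le_div_of_nonneg_left (norm_nonneg _) (norm_pos_iff.2 hn'.ne') ?_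
  rw [Real.norm_of_nonneg hn'.le, Real.norm_of_nonneg (by positivity)]
  exact hle'

lemma tendsto_mean_spacing {a b : ℕ → ℝ}
    (halim : Tendsto (fun k : ℕ => (∑ i ∈ Finset.range k, a i) / k) atTop (𝓝 1))
    (hblim : Tendsto (fun k : ℕ => (∑ i ∈ Finset.range k, b i) / k) atTop (𝓝 1)) :
    Tendsto (fun n : ℕ => (∑ j ∈ Finset.range (n + 1), spacing a b n j) / ((n : ℝ) + 1)) atTop
      (𝓝 1) := by
  have h1 : Tendsto (fun n : ℕ => (n + 1) / 2) atTop atTop :=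
    tendsto_atTop.2 fun m => eventually_atTop.2 ⟨2 * m, fun n hn => by omega⟩
  have h2 : Tendsto (fun n : ℕ => n + 1 - (n + 1) / 2) atTop atTop :=
    tendsto_atTop.2 fun m => eventually_atTop.2 ⟨2 * m, fun n hn => by omega⟩
  have h := ((tendsto_sum_sub_div halim h1 fun n => by omega).add
    (tendsto_sum_sub_div hblim h2 fun n => by omega)).add_const 1
  simp only [add_zero, zero_add] at h
  refine h.congr fun n => ?_
  rw [sum_spacing_total]
  have hn : ((n : ℝ) + 1) ≠ 0 := by positivity
  have hc : (((n + 1) / 2 : ℕ) : ℝ) + ((n + 1 - (n + 1) / 2 : ℕ) : ℝ) = n + 1 := by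
    rw [← Nat.cast_add, Nat.add_sub_cancel' (by omega)]
    push_cast; ring
  field_simp
  linarith

lemma tendsto_scaledSaving {a b : ℕ → ℝ} (ha : ∀ k, 0 < a k) (hb : ∀ k, 0 < b k)
    (halim : Tendsto (fun k : ℕ => (∑ i ∈ Finset.range k, a i) / k) atTop (𝓝 1))
    (hblim : Tendsto (fun k : ℕ => (∑ i ∈ Finset.range k, b i) / k) atTop (𝓝 1)) :
    Tendsto (fun n => scaledSaving (spacing a b n) n) atTop (𝓝 (max (maxGap a) (maxGap b))) := by
  have hr := tendsto_mean_spacing halim hblim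
  have hr' : ∀ c : ℝ, Tendsto (fun n : ℕ =>
      c * ((∑ j ∈ Finset.range (n + 1), spacing a b n j) / ((n : ℝ) + 1))) atTop (𝓝 c) :=
    fun c => by simpa using hr.const_mul c
  have h1 : Tendsto (fun n : ℕ => (n + 1) / 2) atTop atTop :=
    tendsto_atTop.2 fun m => eventually_atTop.2 ⟨2 * m, fun n hn => by omega⟩
  have h2 : Tendsto (fun n : ℕ => n + 1 - (n + 1) / 2) atTop atTop :=
    tendsto_atTop.2 fun m => eventually_atTop.2 ⟨2 * m, fun n hn => by omega⟩
  refine tendsto_order.2 ⟨fun c hc => ?_, fun c hc => ?_⟩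
  -- Lower bound: one gap with value above `c'` eventually belongs to its half for every large `n`.
  · obtain ⟨c', hcc', hc'⟩ := exists_between hc
    rcases lt_max_iff.1 hc' with h | h
    · obtain ⟨k, hk⟩ := exists_lt_of_lt_ciSup h
      filter_upwards [(hr' c').eventually (gt_mem_nhds hk), h1.eventually_gt_atTop k] with n hn hkn
      refine hcc'.trans_le (not_lt.1 fun hlt => ?_)
      exact lt_asymm hn ((forall_gaps_lt_of_scaledSaving_lt ha hb hlt).1 k hkn)
    · obtain ⟨k, hk⟩ := exists_lt_of_lt_ciSup h
      filter_upwards [(hr' c').eventually (gt_mem_nhds hk), h1.eventually_gt_atTop k] with n hn hkn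
      refine hcc'.trans_le (not_lt.1 fun hlt => ?_)
      exact lt_asymm hn ((forall_gaps_lt_of_scaledSaving_lt ha hb hlt).2 k hkn)
  · obtain ⟨c', hc', hcc'⟩ := exists_between hc
    obtain ⟨hca, hcb⟩ := max_lt_iff.1 hc'
    have hc0 : 0 < c' := (maxGap_pos ha halim).trans hca
    obtain ⟨A, hA0, hA, -, hA'⟩ := exists_linear_bounds ha halim
    obtain ⟨B, hB0, hB, -, hB'⟩ := exists_linear_bounds hb hblim
    -- With `h = (n + 1) / 2 ≥ K`, a gap seen from the far side is worth at most `A + h / 5 - 9/10 *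
    -- h`, or the same with `B`, which is negative.
    obtain ⟨K, hK⟩ := exists_nat_gt (2 * (A + B + 1))
    filter_upwards [(hr' c).eventually (lt_mem_nhds hcc'), h1.eventually hA', h2.eventually hB',
      h1.eventually_ge_atTop K] with n hn hAn hBn hKn
    have hK' : (K : ℝ) ≤ ((n + 1) / 2 : ℕ) := by exact_mod_cast hKn
    have hh : (((n + 1) / 2 : ℕ) : ℝ) ≤ ((n + 1 - (n + 1) / 2 : ℕ) : ℝ) := by
      exact_mod_cast (by omega)
    refine scaledSaving_lt_of_forall_gaps_lt ha hb hn.le (fun k => ?_) (fun k => ?_)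
      (fun k hk => ?_) (fun k hk => ?_)
    · exact (gap_le_maxGap ha halim k).trans_lt hca
    · exact (gap_le_maxGap hb hblim k).trans_lt hcb
    · have hk' : (k : ℝ) ≤ ((n + 1) / 2 : ℕ) := by exact_mod_cast hk.le
      linarith [hA k]
    · have hk' : (k : ℝ) ≤ ((n + 1) / 2 : ℕ) := by exact_mod_cast (by omega)
      linarith [hB k]

/-! ### The limit theorem -/

lemma measurable_minTravelTime (n : ℕ) :
    Measurable fun v : Fin n → ℝ => minTravelTime fun i => ((v i : ℝ) : UnitAddCircle) := by
  unfold minTravelTime travelTime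
  refine Measurable.iInf fun σ => Continuous.measurable ?_
  have hsite : ∀ k : Fin (n + 1), Continuous fun v : Fin n → ℝ =>
      (Fin.cons 0 ((fun i => ((v i : ℝ) : UnitAddCircle)) ∘ σ) : Fin (n + 1) → UnitAddCircle) k := by
    intro k
    refine Fin.cases ?_ (fun j => ?_) k
    · simpa using continuous_const
    · simp only [Fin.cons_succ, Function.comp]
      exact (AddCircle.continuous_mk' 1).comp (continuous_apply _)
  exact continuous_finsetSum _ fun i _ => (hsite _).dist (hsite _)

lemma partialSums_natCast (w : ℕ → ℝ) {n : ℕ} (i : Fin n) :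
    partialSums (fun j : Fin n => w j) i = ∑ j ∈ Finset.range (i + 1), w j := by
  rw [partialSums_apply]
  simp only [Fin.le_def]
  rw [Fin.sum_univ_eq_sum_range (fun j => if j ≤ i.1 then w j else 0) n, ← Finset.sum_filter]
  refine Finset.sum_congr ?_ fun _ _ => rfl
  ext j
  simp only [Finset.mem_filter, Finset.mem_range]
  omega

/-- The places of the spacings in `spacing` among the two sequences. -/
def spacingIndex (n : ℕ) (i : Fin (n + 1)) : ℕ ⊕ ℕ :=
  if i.1 < (n + 1) / 2 then .inl i else .inr (n - i)

lemma spacingIndex_injective (n : ℕ) : Function.Injective (spacingIndex n) := by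
  intro i j h
  have hi := i.2
  have hj := j.2
  unfold spacingIndex at h
  split_ifs at h <;> simp at h <;> ext <;> omega

lemma scaledSaving_spacing_eq {Ω : Type*} (Y : ℕ ⊕ ℕ → Ω → ℝ) (n : ℕ) (ω : Ω) :
    scaledSaving (spacing (fun k => Y (.inl k) ω) (fun k => Y (.inr k) ω) n) n
      = ((n : ℝ) + 1) * (1 - minTravelTime fun i : Fin n =>
        ((normalizedSums (fun k => Y (spacingIndex n k) ω) i : ℝ) : UnitAddCircle)) := by
  have h : (fun k : Fin (n + 1) => Y (spacingIndex n k) ω)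
      = fun k : Fin (n + 1) => spacing (fun k => Y (.inl k) ω) (fun k => Y (.inr k) ω) n k := by
    funext k
    unfold spacingIndex spacing
    split_ifs <;> rfl
  rw [h, scaledSaving]
  simp only [normalizedSums, partialSums_natCast, Fin.val_castSucc, Fin.val_last]

section

variable {Ω : Type*} [MeasurableSpace Ω] {ν : Measure Ω}

lemma measurable_scaledSaving {Y : ℕ ⊕ ℕ → Ω → ℝ} (hY : ∀ i, Measurable (Y i)) (n : ℕ) :
    Measurable fun ω =>
      scaledSaving (spacing (fun k => Y (.inl k) ω) (fun k => Y (.inr k) ω) n) n := by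
  simp_rw [scaledSaving_spacing_eq]
  have h1 : Measurable fun ω k => Y (spacingIndex n k) ω := measurable_pi_iff.2 fun k => hY _
  exact measurable_const.mul (measurable_const.sub
    ((measurable_minTravelTime n).comp (measurable_normalizedSums.comp h1)))

/-- The saving does not depend on the labelling of the items, so the exchange of uniforms for
exponential spacings applies to the indicator of each of its preimages. -/
lemma map_saving_eq_map_scaledSaving {Ω₁ : Type*} [MeasurableSpace Ω₁] {μ : Measure Ω₁} {n : ℕ}
    {U : Fin n → Ω₁ → ℝ} (hU : ∀ i, HasLaw (U i) (volume.restrict (Set.Ico (0 : ℝ) 1)) μ)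
    (hUindep : iIndepFun U μ) {Y : ℕ ⊕ ℕ → Ω → ℝ} (hY : IsIIDExp Y ν) :
    μ.map (fun ω => ((n : ℝ) + 1) * (1 - minTravelTime fun i => ((U i ω : ℝ) : UnitAddCircle)))
      = ν.map fun ω =>
        scaledSaving (spacing (fun k => Y (.inl k) ω) (fun k => Y (.inr k) ω) n) n := by
  let φ : (Fin n → ℝ) → ℝ := fun v =>
    ((n : ℝ) + 1) * (1 - minTravelTime fun i => ((v i : ℝ) : UnitAddCircle))
  have hφ : Measurable φ :=
    measurable_const.mul (measurable_const.sub (measurable_minTravelTime n))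
  have hUlaw := hUindep.hasLaw_pi hU
  have hW := hY.precomp (spacingIndex_injective n)
  have hWlaw := hW.indep.hasLaw_pi hW.hasLaw
  simp_rw [scaledSaving_spacing_eq]
  have e1 := AEMeasurable.map_map_of_aemeasurable hφ.aemeasurable hUlaw.aemeasurable
  have e2 := AEMeasurable.map_map_of_aemeasurable
    (hφ.comp measurable_normalizedSums).aemeasurable hWlaw.aemeasurable
  rw [hUlaw.map_eq] at e1
  rw [hWlaw.map_eq] at e2
  refine e1.symm.trans (Eq.trans ?_ e2)
  ext A hA
  have hf : Measurable ((φ ⁻¹' A).indicator (1 : (Fin n → ℝ) → ENNReal)) :=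
    measurable_one.indicator (hφ hA)
  have hsymm : ∀ v (σ : Equiv.Perm (Fin n)),
      (φ ⁻¹' A).indicator (1 : (Fin n → ℝ) → ENNReal) (v ∘ σ) = (φ ⁻¹' A).indicator 1 v := by
    intro v σ
    have : φ (v ∘ σ) = φ v := by
      simp only [φ]
      congr 2
      exact minTravelTime_comp_perm (fun i => ((v i : ℝ) : UnitAddCircle)) σ
    have hmem : v ∘ σ ∈ φ ⁻¹' A ↔ v ∈ φ ⁻¹' A := by
      rw [Set.mem_preimage, Set.mem_preimage, this]
    by_cases hv : v ∈ φ ⁻¹' A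
    · rw [Set.indicator_of_mem hv, Set.indicator_of_mem (hmem.2 hv)]
      rfl
    · rw [Set.indicator_of_notMem hv, Set.indicator_of_notMem (hmem.not.2 hv)]
  have h := lintegral_pi_uniform_eq_lintegral_pi_exp hf hsymm
  rw [lintegral_indicator_one (hφ hA)] at h
  rw [Measure.map_apply hφ hA, Measure.map_apply (hφ.comp measurable_normalizedSums) hA, h,
    ← lintegral_indicator_one ((hφ.comp measurable_normalizedSums) hA)]
  rfl

/-- Serves twice, with `jSet` for the series and with `gapSet` for the suprema. -/
lemma IsIIDExp.measureReal_max_le {Y : ℕ ⊕ ℕ → Ω → ℝ} (hY : IsIIDExp Y ν)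
    {S : ℝ → Set (ℕ → ℝ)} (hS : ∀ t, MeasurableSet (S t))
    (hlaw : ∀ {Z : ℕ → Ω → ℝ}, IsIIDExp Z ν → ∀ {t : ℝ}, 0 ≤ t →
      ν.real {ω | (fun k => Z k ω) ∈ S t} = limitP t)
    {F G : Ω → ℝ} (hF : ∀ᵐ ω ∂ν, ∀ t, F ω ≤ t ↔ (fun k => Y (.inl k) ω) ∈ S t)
    (hG : ∀ᵐ ω ∂ν, ∀ t, G ω ≤ t ↔ (fun k => Y (.inr k) ω) ∈ S t)
    (hpos : ∀ᵐ ω ∂ν, 0 ≤ F ω) (t : ℝ) :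
    ν.real {ω | max (F ω) (G ω) ≤ t} = limitP (max t 0) ^ 2 := by
  rcases lt_or_ge t 0 with ht | ht
  · rw [max_eq_right ht.le, limitP_at_zero, zero_pow two_ne_zero, measureReal_def]
    have : ν {ω | max (F ω) (G ω) ≤ t} = 0 := by
      rw [measure_eq_zero_iff_ae_notMem]
      filter_upwards [hpos] with ω hω h
      exact absurd ((le_max_left _ _).trans h) (not_le.2 (ht.trans_le hω))
    rw [this, ENNReal.toReal_zero]
  · rw [max_eq_left ht]
    have e : {ω | max (F ω) (G ω) ≤ t} =ᵐ[ν]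
        ({ω | (fun k => Y (.inl k) ω) ∈ S t} ∩ {ω | (fun k => Y (.inr k) ω) ∈ S t} : Set Ω) := by
      filter_upwards [hF, hG] with ω h1 h2
      apply propext
      change max (F ω) (G ω) ≤ t ↔
        ((fun k => Y (.inl k) ω) ∈ S t ∧ (fun k => Y (.inr k) ω) ∈ S t)
      rw [max_le_iff, h1, h2]
    rw [measureReal_congr e, hY.measureReal_inter (hS t) (hS t),
      hlaw (hY.precomp Sum.inl_injective) ht, hlaw (hY.precomp Sum.inr_injective) ht, sq]

/-- Almost surely equal, everywhere positive and measurable versions of exponential variables. -/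
lemma exists_isIIDExp_ae_eq {ι : Type*} [Countable ι] {X : ι → Ω → ℝ}
    (hX : ∀ i, HasLaw (X i) (expMeasure 1) ν) (hindep : iIndepFun X ν) :
    ∃ Y : ι → Ω → ℝ, IsIIDExp Y ν ∧ ∀ᵐ ω ∂ν, ∀ i, X i ω = Y i ω := by
  have hpos : ∀ i, ∀ᵐ ω ∂ν, 0 < X i ω := by
    intro i
    rw [(hX i).ae_iff (p := fun x => 0 < x) (measurable_const.lt measurable_id), ae_iff]
    have hm : MeasurableSet {x : ℝ | ¬0 < x} := (measurableSet_lt measurable_const measurable_id).compl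
    rw [← lintegral_indicator_one hm, lintegral_expMeasure_one (measurable_one.indicator hm)]
    refine setLIntegral_eq_zero measurableSet_Ioi fun x hx => ?_
    have : 0 < x := hx
    simp [Set.indicator, this]
  let g : ι → Ω → ℝ := fun i => (hX i).aemeasurable.mk (X i)
  have hg : ∀ i, Measurable (g i) := fun i => (hX i).aemeasurable.measurable_mk
  let Y : ι → Ω → ℝ := fun i ω => if 0 < g i ω then g i ω else 1
  have hXY : ∀ i, X i =ᵐ[ν] Y i := by
    intro i
    filter_upwards [hpos i, (hX i).aemeasurable.ae_eq_mk] with ω h1 h2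
    have h3 : X i ω = g i ω := h2
    simp only [Y]
    rw [← h3, if_pos h1]
  refine ⟨Y, ⟨fun i => ?_, fun i ω => ?_, fun i => (hX i).congr (hXY i).symm,
    hindep.congr hXY⟩, ae_all_iff.2 hXY⟩
  · exact Measurable.ite (measurableSet_lt measurable_const (hg i)) (hg i) measurable_const
  · simp only [Y]
    split_ifs with h
    exacts [h, one_pos]

end

theorem theorem4p2
    {Ω : ℕ → Type*} [∀ n, MeasurableSpace (Ω n)]
    (μ : ∀ n, Measure (Ω n)) [∀ n, IsProbabilityMeasure (μ n)]
    (U : ∀ n, Fin n → Ω n → ℝ)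
    (hU : ∀ n i, HasLaw (U n i) (volume.restrict (Set.Ico (0 : ℝ) 1)) (μ n))
    (hUindep : ∀ n, iIndepFun (U n) (μ n))
    (T : ∀ n, Ω n → ℝ)
    (hT : ∀ n ω, T n ω = minTravelTime (fun i => ((U n i ω : ℝ) : UnitAddCircle)))
    {Ω' : Type*} [MeasurableSpace Ω'] (ν : Measure Ω') [IsProbabilityMeasure ν]
    (X X' : ℕ → Ω' → ℝ)
    (hX : ∀ j, HasLaw (X j) (expMeasure 1) ν)
    (hX' : ∀ j, HasLaw (X' j) (expMeasure 1) ν)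
    (hindep : iIndepFun (Sum.elim X X') ν) :
    (∀ᵐ ω ∂ν, Summable (jTerm fun j => X j ω) ∧ Summable (jTerm fun j => X' j ω)) ∧
    TendstoInDistribution (fun (n : ℕ) (ω : Ω n) => ((n : ℝ) + 1) * (1 - T n ω)) atTop
      (fun ω => max (∑' j, jTerm (fun j => X j ω) j) (∑' j, jTerm (fun j => X' j ω) j)) μ ν ∧
    ∀ t : ℝ, 0 ≤ t →
      Summable (pTerm t) ∧
      ν.real {ω | max (∑' j, jTerm (fun j => X j ω) j) (∑' j, jTerm (fun j => X' j ω) j) ≤ t}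
        = limitP t ^ 2 ∧
      Tendsto (fun n : ℕ => (μ n).real {ω | T n ω > 1 - t / ((n : ℝ) + 1)}) atTop
        (𝓝 (limitP t ^ 2)) := by
  obtain ⟨Y, hY, hXY⟩ := exists_isIIDExp_ae_eq (X := Sum.elim X X') (ν := ν)
    (fun i => by cases i; exacts [hX _, hX' _]) hindep
  have hYl := hY.precomp Sum.inl_injective
  have hYr := hY.precomp Sum.inr_injective
  have hsum : ∀ᵐ ω ∂ν, Summable (jTerm fun j => X j ω) ∧ Summable (jTerm fun j => X' j ω) := by
    filter_upwards [hXY, hYl.ae_tendsto_mean, hYr.ae_tendsto_mean] with ω h hl hr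
    have e1 : (fun j => X j ω) = fun j => Y (.inl j) ω := funext fun j => h (.inl j)
    have e2 : (fun j => X' j ω) = fun j => Y (.inr j) ω := funext fun j => h (.inr j)
    rw [e1, e2]
    exact ⟨summable_jTerm (fun k => hYl.pos k ω) hl, summable_jTerm (fun k => hYr.pos k ω) hr⟩
  set J : Ω' → ℝ := fun ω => max (∑' j, jTerm (fun j => X j ω) j) (∑' j, jTerm (fun j => X' j ω) j)
    with hJ
  have hJlaw : ∀ t, ν.real {ω | J ω ≤ t} = limitP (max t 0) ^ 2 := by
    refine hY.measureReal_max_le measurableSet_jSet (fun hZ _ ht => hZ.measureReal_jSet ht) ?_ ?_ ?_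
    · filter_upwards [hXY, hYl.ae_tendsto_mean] with ω h hl t
      have e1 : (fun j => X j ω) = fun j => Y (.inl j) ω := funext fun j => h (.inl j)
      rw [e1]
      exact tsum_jTerm_le_iff (fun k => hYl.pos k ω) hl t
    · filter_upwards [hXY, hYr.ae_tendsto_mean] with ω h hr t
      have e2 : (fun j => X' j ω) = fun j => Y (.inr j) ω := funext fun j => h (.inr j)
      rw [e2]
      exact tsum_jTerm_le_iff (fun k => hYr.pos k ω) hr t
    · filter_upwards [hXY] with ω h
      have e1 : (fun j => X j ω) = fun j => Y (.inl j) ω := funext fun j => h (.inl j)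
      rw [e1]
      exact tsum_nonneg fun j => div_nonneg (hYl.pos j ω).le (two_pow_succ_sub_one_pos j).le
  have hJmeas : AEMeasurable J ν := by
    have h : ∀ Z : ℕ → Ω' → ℝ, (∀ j, HasLaw (Z j) (expMeasure 1) ν) →
        (∀ᵐ ω ∂ν, Summable (jTerm fun j => Z j ω)) →
        AEMeasurable (fun ω => ∑' j, jTerm (fun j => Z j ω) j) ν := by
      intro Z hZ hs
      refine aemeasurable_of_tendsto_metrizable_ae atTop
        (f := fun m ω => ∑ j ∈ Finset.range m, jTerm (fun j => Z j ω) j) (fun m => ?_) ?_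
      · exact Finset.aemeasurable_fun_sum _ fun j _ => (hZ j).aemeasurable.div_const _
      · filter_upwards [hs] with ω hω
        exact hω.hasSum.tendsto_sum_nat
    exact (h X hX (hsum.mono fun _ h => h.1)).max (h X' hX' (hsum.mono fun _ h => h.2))
  -- The same exponentials also act as spacings, so the almost sure limit lives on the space of the
  -- series.
  set M : Ω' → ℝ := fun ω =>
    max (maxGap fun k => Y (.inl k) ω) (maxGap fun k => Y (.inr k) ω) with hM
  have hMlim : ∀ᵐ ω ∂ν, Tendsto (fun n => scaledSaving
      (spacing (fun k => Y (.inl k) ω) (fun k => Y (.inr k) ω) n) n) atTop (𝓝 (M ω)) := by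
    filter_upwards [hYl.ae_tendsto_mean, hYr.ae_tendsto_mean] with ω hl hr
    exact tendsto_scaledSaving (fun k => hYl.pos k ω) (fun k => hYr.pos k ω) hl hr
  have hmeas : ∀ n, Measurable fun ω => scaledSaving
      (spacing (fun k => Y (.inl k) ω) (fun k => Y (.inr k) ω) n) n :=
    measurable_scaledSaving hY.measurable
  have hMmeas : AEMeasurable M ν :=
    aemeasurable_of_tendsto_metrizable_ae atTop (fun n => (hmeas n).aemeasurable) hMlim
  have hMlaw : ∀ t, ν.real {ω | M ω ≤ t} = limitP (max t 0) ^ 2 := by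
    refine hY.measureReal_max_le measurableSet_gapSet (fun hZ _ ht => hZ.measureReal_gapSet ht)
      ?_ ?_ ?_
    · filter_upwards [hYl.ae_tendsto_mean] with ω hl t
      exact maxGap_le_iff (fun k => hYl.pos k ω) hl t
    · filter_upwards [hYr.ae_tendsto_mean] with ω hr t
      exact maxGap_le_iff (fun k => hYr.pos k ω) hr t
    · filter_upwards [hYl.ae_tendsto_mean] with ω hl
      exact (maxGap_pos (fun k => hYl.pos k ω) hl).le
  have hpJ := Measure.isProbabilityMeasure_map hJmeas
  have hpM := Measure.isProbabilityMeasure_map hMmeas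
  have hcdfJ : ∀ t, cdf (ν.map J) t = limitP (max t 0) ^ 2 := fun t => by
    rw [cdf_eq_real, map_measureReal_apply_of_aemeasurable hJmeas measurableSet_Iic, ← hJlaw t]
    rfl
  have hcdfM : ∀ t, cdf (ν.map M) t = limitP (max t 0) ^ 2 := fun t => by
    rw [cdf_eq_real, map_measureReal_apply_of_aemeasurable hMmeas measurableSet_Iic, ← hMlaw t]
    rfl
  -- Convergence in distribution sees only laws, so `J` can replace the almost sure limit `M`.
  have hlaw : ν.map J = ν.map M :=
    Measure.eq_of_cdf _ _ (StieltjesFunction.ext fun t => by rw [hcdfJ, hcdfM])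
  have hS := tendstoInDistribution_of_ae_tendsto (fun n => (hmeas n).aemeasurable) hMmeas hMlim
  have hTmap : ∀ n : ℕ, (μ n).map (fun ω => ((n : ℝ) + 1) * (1 - T n ω)) = ν.map fun ω =>
      scaledSaving (spacing (fun k => Y (.inl k) ω) (fun k => Y (.inr k) ω) n) n := fun n => by
    simp_rw [hT]
    exact map_saving_eq_map_scaledSaving (hU n) (hUindep n) hY
  have hTmeas : ∀ n : ℕ, AEMeasurable (fun ω => ((n : ℝ) + 1) * (1 - T n ω)) (μ n) := fun n => by
    simp_rw [hT]
    exact (((measurable_minTravelTime n).comp_aemeasurable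
      (aemeasurable_pi_iff.2 fun i => (hU n i).aemeasurable)).const_sub 1).const_mul _
  have hdist : TendstoInDistribution (fun (n : ℕ) (ω : Ω n) => ((n : ℝ) + 1) * (1 - T n ω)) atTop
      J μ ν := by
    refine ⟨hTmeas, hJmeas, ?_⟩
    have hlim : (⟨ν.map J, hpJ⟩ : ProbabilityMeasure ℝ) = ⟨ν.map M, hpM⟩ := Subtype.ext hlaw
    rw [hlim]
    exact hS.tendsto.congr fun n => Subtype.ext (hTmap n).symm
  refine ⟨hsum, hdist, fun t ht => ⟨summable_pTerm ht, ?_, ?_⟩⟩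
  · rw [hJlaw, max_eq_left ht]
  -- The event is a strict inequality for the saving, so the limit law must not charge the boundary
  -- point `t`.
  · have hnull : (ν.map J) {t} = 0 := by
      rw [← measure_cdf (ν.map J), StieltjesFunction.measure_singleton]
      have hc : Continuous (cdf (ν.map J)) := by
        rw [funext hcdfJ]
        exact continuous_limitP_max.pow 2
      rw [hc.continuousWithinAt.leftLim_eq, sub_self, ENNReal.ofReal_zero]
    have h1 := ProbabilityMeasure.tendsto_measure_of_null_frontier_of_tendsto' hdist.tendsto
      (E := Set.Iio t) (by rw [frontier_Iio]; exact hnull)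
    have h2 := (ENNReal.tendsto_toReal (measure_ne_top (ν.map J) (Set.Iio t))).comp h1
    have h3 : ((ν.map J) (Set.Iio t)).toReal = limitP t ^ 2 := by
      rw [measure_congr (Iio_ae_eq_Iic' hnull), ← measureReal_def, ← cdf_eq_real, hcdfJ, max_eq_left ht]
    have h4 := h3 ▸ h2
    refine h4.congr fun n => ?_
    have hn : (0 : ℝ) < n + 1 := by positivity
    change ((μ n).map (fun ω => ((n : ℝ) + 1) * (1 - T n ω)) (Set.Iio t)).toReal = _
    rw [Measure.map_apply_of_aemeasurable (hTmeas n) measurableSet_Iio, measureReal_def]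
    congr 2
    ext ω
    change ((n : ℝ) + 1) * (1 - T n ω) < t ↔ T n ω > 1 - t / ((n : ℝ) + 1)
    rw [mul_comm, ← lt_div_iff₀ hn]
    constructor <;> intro h <;> linarith
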